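/- Conventions. A tt-category $\mathcal K$ is a triangulated category with suspension $\Sigma$ and a symmetric monoidal structure $(\otimes,\mathbb 1)$ that is exact in each variable; it is rigid if every object has a dual. $\mathrm{Spc}(\mathcal K)$ is the space of prime tt-ideals $\mathcal P$, with the topology generated by the sets $\{\mathcal P\mid a\in\mathcal P\}$, $a\in\mathcal K$. For a morphism $s$ put $U(s)=\{\mathcal P\mid \mathrm{cone}(s)\in\mathcal P\}$. The period of a tt-category is the smallest $d>0$ with $\mathbb 1\cong\Sigma^d\mathbb 1$, or $0$ if there is none; the local period is $\mathrm{per}_{\mathcal K}(\mathcal P)=\mathrm{per}(\mathcal K/\mathcal P)$, where $\mathcal K/\mathcal P$ is the Verdier quotient. The period of a $\mathbb Z$-graded ring is the smallest degree $d>0$ of a homogeneous unit, or $0$ if there is none. For a homogeneous prime $\mathfrak q$ of a graded ring $R$ put $\mathrm{per}_R(\mathfrak q)=\mathrm{per}(R_{\mathfrak q})$, where $R_{\mathfrak q}$ is obtained from $R$ by inverting all homogeneous elements outside $\mathfrak q$. Let $R_{\mathcal K}=\bigoplus_{d\in\mathbb Z}\mathrm{Hom}_{\mathcal K}(\Sigma^d\mathbb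 1,\mathbb 1)$ be the graded endomorphism ring of the unit. A line bundle is a $\otimes$-invertible object that is, locally on $\mathrm{Spc}(\mathcal K)$, isomorphic to a shift of $\mathbb 1$; it is base-free if the sets $U(s)$, for $s\colon\mathbb 1\to\Sigma^dx$ and $d\in\mathbb Z$, cover $\mathrm{Spc}(\mathcal K)$. Let $x_1,\dots,x_N$ be line bundles, and let $M\subseteq\mathrm{Pic}(\mathcal K)$ be the submonoid generated by them and by all shifts $\Sigma^d\mathbb 1$, $d\in\mathbb Z$. The family is ample if the sets $U(s)$, for $s\colon\mathbb 1\to m$ and $m\in M$, form a basis of the topology of $\mathrm{Spc}(\mathcal K)$. The central 2-ring $\mathcal R_M$ has as objects the objects $g$ of $\mathcal K$ whose class lies in the subgroup of $\mathrm{Pic}(\mathcal K)$ generated by $M$, and $\mathcal R_M(g,h)=\mathcal K(g,h)$ if $h\cong m\otimes g$ for some $m\in M$, and $\mathcal R_M(g,h)=0$ otherwise. A homogeneous prime of $\mathcal R_M$ is a proper ideal of morphisms, closed under tensoring with objects, such that $s\circ r\in\mathfrak p$ implies $s\in\mathfrak p$ or $r\in\mathfrak p$. The points of the graded scheme $P\{x_i\}$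 are the homogeneous primes $\mathfrak p$ of $\mathcal R_M$ for which there are sections $s_i\colon\mathbb 1\to\Sigma^{d_i}x_i$ with $s_i\notin\mathfrak p$ for all $i$. For each such choice $\underline s=(s_i)_i$ the open set $D(\underline s)=\{\mathfrak p\mid s_i\notin\mathfrak p\text{ for all }i\}$ is an affine chart, identified with the homogeneous spectrum of the graded ring $R_{\mathcal K[\underline s^{-1}]}$, where $\mathcal K[\underline s^{-1}]=\mathcal K/\langle\mathrm{cone}(s_1),\dots,\mathrm{cone}(s_N)\rangle$; a point $\mathfrak p$ corresponds to the homogeneous prime $\mathfrak p_{\underline s}$ generated by the fractions $b\circ t^{-1}\colon\Sigma^d\mathbb 1\to\mathbb 1$ with $b\in\mathfrak p$ and $t$ a morphism of $\mathcal R_M$ that is invertible in $\mathcal K[\underline s^{-1}]$. The local graded ring of $P\{x_i\}$ at $\mathfrak p$ is $(R_{\mathcal K[\underline s^{-1}]})_{\mathfrak p_{\underline s}}$, and $\mathrm{per}_{P\{x_i\}}(\mathfrak p)$ is its period. Theorem. Let $\mathcal K$ be a rigid (essentially small) tt-category. (1) Let $x_1,\dots,x_N$ be a finite ample family of base-free line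 bundles of $\mathcal K$. Then $\mathcal P\mapsto\mathfrak p=\{r\in\mathcal R_M\mid\mathrm{cone}(r)\notin\mathcal P\}$ is a well-defined map from $\mathrm{Spc}(\mathcal K)$ to the set of homogeneous primes of $\mathcal R_M$. For each $\mathcal P\in\mathrm{Spc}(\mathcal K)$ the image $\mathfrak p$ lies in $P\{x_i\}$, and $$\mathrm{per}_{\mathcal K}(\mathcal P)=\mathrm{per}_{P\{x_i\}}(\mathfrak p),$$ where the right hand side may be computed in any chart $D(\underline s)$ that contains $\mathfrak p$. (2) There is a map $\mathrm{comp}_{\mathcal K}\colon\mathrm{Spc}(\mathcal K)\to\mathrm{Spc}^{\mathrm h}(R_{\mathcal K})$ to the homogeneous spectrum, such that a homogeneous element $f$ lies in $\mathrm{comp}_{\mathcal K}(\mathcal P)$ if and only if $\mathrm{cone}(f)\notin\mathcal P$. If $\mathrm{comp}_{\mathcal K}$ is a homeomorphism onto its image, then $\mathrm{per}_{\mathcal K}(\mathcal P)=\mathrm{per}_{R_{\mathcal K}}(\mathrm{comp}_{\mathcal K}(\mathcal P))$ for every $\mathcal P\in\mathrm{Spc}(\mathcal K)$. -/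

import Mathlib

open CategoryTheory MonoidalCategory Limits Pretriangulated

universe v u w

noncomputable section

namespace TTPeriod

/-! ## Graded rings: homogeneous primes, localization, periods -/

section GradedRings

variable (A : ℤ → Type w) [∀ d, AddCommGroup (A d)] [DirectSum.GRing A]

/-- The `ℤ`-graded ring `R = ⨁ d, A d`. -/
abbrev Total : Type w := DirectSum ℤ A

variable {A} in
/-- The element of `R` given by an element of degree `d`. -/
abbrev hom {d : ℤ} (a : A d) : Total A := DirectSum.of A d a

/-- The period of a graded ring `L`, where `H d` is the set of elements of degree `d`: the smallest
`d > 0` such that there is a unit of degree `d`, and `0` if there is none (`sInf ∅ = 0`). -/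
def gradedPeriod {L : Type*} [Ring L] (H : ℤ → Set L) : ℕ :=
  sInf {d : ℕ | 0 < d ∧ ∃ l ∈ H (d : ℤ), IsUnit l}

/-- A homogeneous prime ideal of `R = ⨁ d, A d`: a proper two-sided ideal, containing the
homogeneous components of its elements, and prime with respect to homogeneous elements. -/
@[ext]
structure HomogeneousPrime where
  toIdeal : Ideal (Total A)
  mul_mem_right : ∀ a b, a ∈ toIdeal → a * b ∈ toIdeal
  component_mem : ∀ a ∈ toIdeal, ∀ d : ℤ, hom (a d) ∈ toIdeal
  ne_top : toIdeal ≠ ⊤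
  mem_or_mem : ∀ (d e : ℤ) (a : A d) (b : A e),
    hom a * hom b ∈ toIdeal → hom a ∈ toIdeal ∨ hom b ∈ toIdeal

/-- The Zariski topology on the homogeneous spectrum, generated by the sets
`D(f) = {𝔭 | f ∉ 𝔭}` with `f` homogeneous. -/
instance : TopologicalSpace (HomogeneousPrime A) :=
  TopologicalSpace.generateFrom
    {U | ∃ (d : ℤ) (f : A d), U = {𝔭 : HomogeneousPrime A | hom f ∉ 𝔭.toIdeal}}

variable {A}

/-- The homogeneous elements of `R` (together with a degree) outside of `I`. -/
def HomCompl (I : Ideal (Total A)) : Type w := {s : (d : ℤ) × A d // hom s.2 ∉ I}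

/-- The relations which express that the letters `Sum.inl r` multiply and add up as the elements
`r` of `R`, and that the letter `Sum.inr s` is a two-sided inverse of `Sum.inl s`. -/
inductive LocRel (I : Ideal (Total A)) :
    FreeAlgebra ℤ (Total A ⊕ HomCompl I) → FreeAlgebra ℤ (Total A ⊕ HomCompl I) → Prop
  | one : LocRel I (FreeAlgebra.ι ℤ (Sum.inl 1)) 1
  | add (r r' : Total A) : LocRel I (FreeAlgebra.ι ℤ (Sum.inl (r + r')))
      (FreeAlgebra.ι ℤ (Sum.inl r) + FreeAlgebra.ι ℤ (Sum.inl r'))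
  | mul (r r' : Total A) : LocRel I (FreeAlgebra.ι ℤ (Sum.inl (r * r')))
      (FreeAlgebra.ι ℤ (Sum.inl r) * FreeAlgebra.ι ℤ (Sum.inl r'))
  | mul_inv (s : HomCompl I) : LocRel I
      (FreeAlgebra.ι ℤ (Sum.inl (hom s.1.2)) * FreeAlgebra.ι ℤ (Sum.inr s)) 1
  | inv_mul (s : HomCompl I) : LocRel I
      (FreeAlgebra.ι ℤ (Sum.inr s) * FreeAlgebra.ι ℤ (Sum.inl (hom s.1.2))) 1

/-- The localization of `R` at `I`: the ring obtained from `R` by universally inverting all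
homogeneous elements outside of `I`. In the rings `R` of interest homogeneous elements commute up
to units of degree `0`, so that for a homogeneous prime `I` this is the usual graded local ring
`R_I`, whose elements of degree `d` are the fractions `a / s` with `s ∉ I` homogeneous and `a` of
degree `d + deg s`. -/
abbrev LocalRing (I : Ideal (Total A)) : Type w := RingQuot (LocRel I)

/-- The canonical map from `R` to its localization. -/
def LocalRing.ofRing (I : Ideal (Total A)) (r : Total A) : LocalRing I :=
  RingQuot.mkRingHom _ (FreeAlgebra.ι ℤ (Sum.inl r))

/-- The inverse of a homogeneous element outside of `I` in the localization. -/
def LocalRing.inv (I : Ideal (Total A)) (s : HomCompl I) : LocalRing I :=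
  RingQuot.mkRingHom _ (FreeAlgebra.ι ℤ (Sum.inr s))

/-- The grading of the localization: `LocalRing.IsHomogeneous I d l` says that `l` is of degree
`d`. -/
inductive LocalRing.IsHomogeneous (I : Ideal (Total A)) : ℤ → LocalRing I → Prop
  | ofRing {d : ℤ} (a : A d) : IsHomogeneous I d (LocalRing.ofRing I (hom a))
  | inv (s : HomCompl I) : IsHomogeneous I (-s.1.1) (LocalRing.inv I s)
  | add {d : ℤ} {l l' : LocalRing I} :
      IsHomogeneous I d l → IsHomogeneous I d l' → IsHomogeneous I d (l + l')
  | mul {d e : ℤ} {l l' : LocalRing I} :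
      IsHomogeneous I d l → IsHomogeneous I e l' → IsHomogeneous I (d + e) (l * l')

/-- The local period of `R` at `I`: the period of the graded local ring at `I`. -/
def ringPeriodAt (I : Ideal (Total A)) : ℕ :=
  gradedPeriod (fun d => {l : LocalRing I | LocalRing.IsHomogeneous I d l})

end GradedRings

/-! ## The graded endomorphism ring of an object -/

section GradedEnd

variable {C : Type u} [Category.{v} C] [HasShift C ℤ]

/-- The product of `f : Σᵐ X ⟶ X` and `g : Σⁿ X ⟶ X` is
`f ∘ Σᵐ g : Σᵐ⁺ⁿ X = Σᵐ Σⁿ X ⟶ Σᵐ X ⟶ X`. -/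
def shiftMul {X : C} {m n k : ℤ} (f : X⟦m⟧ ⟶ X) (g : X⟦n⟧ ⟶ X) (h : n + m = k) : X⟦k⟧ ⟶ X :=
  (shiftFunctorAdd' C n m k h).hom.app X ≫ g⟦m⟧' ≫ f

theorem one_shiftMul {X : C} {n : ℤ} (g : X⟦n⟧ ⟶ X) :
    shiftMul ((shiftFunctorZero C ℤ).hom.app X) g (add_zero n) = g := by
  have := (shiftFunctorZero C ℤ).hom.naturality g
  dsimp [shiftMul] at this ⊢
  rw [this, shiftFunctorAdd'_add_zero_hom_app]
  simp

theorem shiftMul_one {X : C} {n : ℤ} (g : X⟦n⟧ ⟶ X) :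
    shiftMul g ((shiftFunctorZero C ℤ).hom.app X) (zero_add n) = g := by
  dsimp [shiftMul]
  rw [shiftFunctorAdd'_zero_add_hom_app, ← Functor.map_comp_assoc]
  simp

theorem shiftMul_assoc {X : C} {a b c ab bc k : ℤ} (f : X⟦a⟧ ⟶ X) (g : X⟦b⟧ ⟶ X) (h : X⟦c⟧ ⟶ X)
    (hab : b + a = ab) (hbc : c + b = bc) (hk : c + ab = k) (hk' : bc + a = k) :
    shiftMul (shiftMul f g hab) h hk = shiftMul f (shiftMul g h hbc) hk' := by
  have h₁ := (shiftFunctorAdd' C b a ab hab).hom.naturality h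
  have h₂ := shiftFunctorAdd'_assoc_hom_app (C := C) c b a bc ab k hbc hab (by omega) X
  dsimp [shiftMul] at h₁ ⊢
  simp only [Functor.map_comp, Category.assoc]
  rw [reassoc_of% h₁, ← reassoc_of% h₂]

theorem mk_shiftMul {X : C} {m n k k' : ℤ} (f : X⟦m⟧ ⟶ X) (g : X⟦n⟧ ⟶ X) (h : n + m = k)
    (h' : n + m = k') :
    (⟨k, shiftMul f g h⟩ : (d : ℤ) × (X⟦d⟧ ⟶ X)) = ⟨k', shiftMul f g h'⟩ := by
  subst h; subst h'; rfl

/-- The morphisms `Σᵈ X ⟶ X`. -/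
def GEnd (X : C) (d : ℤ) : Type v := X⟦d⟧ ⟶ X

instance GEnd.instGMul (X : C) : GradedMonoid.GMul (GEnd X) where
  mul {m n} f g := shiftMul (X := X) (m := m) (n := n) f g (add_comm _ _)

instance GEnd.instGOne (X : C) : GradedMonoid.GOne (GEnd X) where
  one := (shiftFunctorZero C ℤ).hom.app X

instance GEnd.instGMonoid (X : C) : GradedMonoid.GMonoid (GEnd X) where
  one_mul := by
    rintro ⟨n, g⟩
    exact (mk_shiftMul (X := X) _ _ _ (add_zero n)).trans (congrArg (Sigma.mk n) (one_shiftMul g))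
  mul_one := by
    rintro ⟨n, g⟩
    exact (mk_shiftMul (X := X) _ _ _ (zero_add n)).trans (congrArg (Sigma.mk n) (shiftMul_one g))
  mul_assoc := by
    rintro ⟨a, f⟩ ⟨b, g⟩ ⟨c, h⟩
    exact (congrArg (Sigma.mk (a + b + c)) (shiftMul_assoc (X := X) f g h (add_comm b a)
      (add_comm c b) (add_comm c (a + b)) (by omega))).trans (mk_shiftMul (X := X) _ _ _ _)

variable [Preadditive C]

instance (X : C) (d : ℤ) : AddCommGroup (GEnd X d) :=
  inferInstanceAs (AddCommGroup (X⟦d⟧ ⟶ X))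

theorem zero_shiftMul {X : C} {m n k : ℤ} (g : X⟦n⟧ ⟶ X) (h : n + m = k) :
    shiftMul (0 : X⟦m⟧ ⟶ X) g h = 0 := by
  simp [shiftMul]

theorem add_shiftMul {X : C} {m n k : ℤ} (f f' : X⟦m⟧ ⟶ X) (g : X⟦n⟧ ⟶ X) (h : n + m = k) :
    shiftMul (f + f') g h = shiftMul f g h + shiftMul f' g h := by
  simp [shiftMul]

variable [∀ n : ℤ, (shiftFunctor C n).Additive]

theorem shiftMul_zero {X : C} {m n k : ℤ} (f : X⟦m⟧ ⟶ X) (h : n + m = k) :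
    shiftMul f (0 : X⟦n⟧ ⟶ X) h = 0 := by
  simp [shiftMul]

theorem shiftMul_add {X : C} {m n k : ℤ} (f : X⟦m⟧ ⟶ X) (g g' : X⟦n⟧ ⟶ X) (h : n + m = k) :
    shiftMul f (g + g') h = shiftMul f g h + shiftMul f g' h := by
  simp [shiftMul, Functor.map_add]

/-- The graded endomorphism ring `⨁ d, Hom(Σᵈ X, X)`. -/
instance GEnd.instGRing (X : C) : DirectSum.GRing (GEnd X) where
  __ := GEnd.instGMonoid X
  mul_zero _ := shiftMul_zero (X := X) _ _
  zero_mul _ := zero_shiftMul (X := X) _ _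
  mul_add _ _ _ := shiftMul_add (X := X) _ _ _ _
  add_mul _ _ _ := add_shiftMul (X := X) _ _ _ _
  natCast n := n • (show GEnd X 0 from (shiftFunctorZero C ℤ).hom.app X)
  natCast_zero := zero_smul _ _
  natCast_succ n := succ_nsmul _ n
  intCast n := n • (show GEnd X 0 from (shiftFunctorZero C ℤ).hom.app X)
  intCast_ofNat n := natCast_zsmul _ n
  intCast_negSucc_ofNat n := negSucc_zsmul _ n

/-- The smallest `d > 0` with `X ≅ Σᵈ X`, and `0` if there is none (`sInf ∅ = 0`). The period of a
tt-category is this number for its unit object. -/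
def objPeriod (X : C) : ℕ :=
  sInf {d : ℕ | 0 < d ∧ Nonempty (X ≅ X⟦(d : ℤ)⟧)}

end GradedEnd

/-! ## Tensor triangulated categories and their spectra -/

/-- A tensor triangulated category: a triangulated category with a symmetric monoidal structure
such that `a ⊗ -` (and hence, by symmetry, `- ⊗ a`) is exact; the isomorphisms
`a ⊗ Σⁿ x ≅ Σⁿ (a ⊗ x)` are natural in both variables. -/
class TensorTriangulated (K : Type u) [Category.{v} K] [HasZeroObject K] [HasShift K ℤ]
    [Preadditive K] [∀ n : ℤ, (shiftFunctor K n).Additive] [Pretriangulated K]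
    [MonoidalCategory K] [SymmetricCategory K] where
  isTriangulated : IsTriangulated K
  commShift (a : K) : (tensorLeft a).CommShift ℤ
  exact (a : K) : (tensorLeft a).IsTriangulated
  natural {a b : K} (f : a ⟶ b) (x : K) (n : ℤ) :
    f ▷ (x⟦n⟧) ≫ ((tensorLeft b).commShiftIso n).hom.app x =
      ((tensorLeft a).commShiftIso n).hom.app x ≫ (f ▷ x)⟦n⟧'

attribute [instance] TensorTriangulated.isTriangulated TensorTriangulated.commShift
  TensorTriangulated.exact

section Spectrum

variable (K : Type u) [Category.{v} K] [HasZeroObject K] [HasShift K ℤ]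
  [Preadditive K] [∀ n : ℤ, (shiftFunctor K n).Additive] [Pretriangulated K]
  [MonoidalCategory K]

/-- A tt-ideal: a thick triangulated subcategory which is closed under tensoring with arbitrary
objects. -/
@[ext]
structure ThickIdeal where
  carrier : ObjectProperty K
  isTriangulated : carrier.IsTriangulated
  isClosedUnderIsomorphisms : carrier.IsClosedUnderIsomorphisms
  isStableUnderRetracts : carrier.IsStableUnderRetracts
  tensor_mem (a x : K) : carrier x → carrier (a ⊗ x)

attribute [instance] ThickIdeal.isTriangulated ThickIdeal.isClosedUnderIsomorphisms
  ThickIdeal.isStableUnderRetracts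

variable {K}

/-- The smallest tt-ideal which contains the objects in `S`. -/
def ThickIdeal.generatedBy (S : ObjectProperty K) : ThickIdeal K where
  carrier x := ∀ I : ThickIdeal K, S ≤ I.carrier → I.carrier x
  isClosedUnderIsomorphisms := ⟨fun e h I hI => I.carrier.prop_of_iso e (h I hI)⟩
  isStableUnderRetracts := ⟨fun r h I hI => I.carrier.prop_of_retract r (h I hI)⟩
  isTriangulated :=
    { exists_zero := ⟨_, isZero_zero K, fun I _ => I.carrier.prop_zero⟩
      isStableUnderShiftBy := fun n => ⟨fun _ h I hI => I.carrier.le_shift n _ (h I hI)⟩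
      ext₂' := fun T hT h₁ h₃ => ObjectProperty.le_isoClosure _ _ fun I hI =>
        I.carrier.ext_of_isTriangulatedClosed₂ T hT (h₁ I hI) (h₃ I hI) }
  tensor_mem a x h I hI := I.tensor_mem a x (h I hI)

variable (K)

/-- The spectrum of a tt-category: the set of its prime tt-ideals. -/
@[ext]
structure Spectrum extends ThickIdeal K where
  unit_notMem : ¬ carrier (𝟙_ K)
  mem_or_mem (a b : K) : carrier (a ⊗ b) → carrier a ∨ carrier b

/-- The topology on the spectrum generated by the sets `U(a) = {P | a ∈ P}`. -/
instance : TopologicalSpace (Spectrum K) :=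
  TopologicalSpace.generateFrom {U | ∃ a : K, U = {P : Spectrum K | P.carrier a}}

variable {K}

/-- `ConeMem P f` says that (one, equivalently every) cone of `f` belongs to `P`. -/
abbrev Spectrum.ConeMem (P : Spectrum K) {a b : K} (f : a ⟶ b) : Prop := P.carrier.trW f

/-- The open set `U(s)`, the complement of the support of the cone of `s`. -/
def invLocus {a b : K} (s : a ⟶ b) : Set (Spectrum K) := {P | P.ConeMem s}

/-- The objects whose support `{P | a ∉ P}` is contained in `Z`. -/
def supportedOn (Z : Set (Spectrum K)) : ObjectProperty K :=
  fun a => ∀ P : Spectrum K, ¬ P.carrier a → P ∈ Z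

variable [IsTriangulated K]

/-- The Verdier quotient `K / I`. -/
abbrev ThickIdeal.Quotient (I : ThickIdeal K) := I.carrier.trW.Localization

/-- The unit of the tt-category `K / I`, the image of the unit of `K`. -/
abbrev ThickIdeal.unit (I : ThickIdeal K) : I.Quotient := I.carrier.trW.Q.obj (𝟙_ K)

/-- The local period of `K` at `P`, which is the period of the tt-category `K / P`. -/
def Spectrum.period (P : Spectrum K) : ℕ := objPeriod P.toThickIdeal.unit

/-! ## Line bundles and ample families -/

variable (K) in
/-- Every object has a dual. -/
def IsRigid : Prop := ∀ x : K, ∃ y : K, Nonempty (ExactPairing x y)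

/-- A line bundle: an invertible object `x` such that every point of the spectrum has a
quasi-compact open neighborhood `U` for which `x` is isomorphic to a shift of the unit in the
category `K|_U = K / {a | supp a ⊆ Uᶜ}`. -/
def IsLineBundle (x : K) : Prop :=
  (∃ y : K, Nonempty (x ⊗ y ≅ 𝟙_ K)) ∧
    ∀ P : Spectrum K, ∃ U : Set (Spectrum K), IsOpen U ∧ IsCompact U ∧ P ∈ U ∧
      ∃ d : ℤ, Nonempty ((supportedOn Uᶜ).trW.Q.obj x ≅ (supportedOn Uᶜ).trW.Q.obj ((𝟙_ K)⟦d⟧))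

/-- The line bundle `x` is base-free: the sets `U(s)`, for `s` a global section of `x` of some
degree, cover the spectrum. -/
def IsBaseFree (x : K) : Prop :=
  ∀ P : Spectrum K, ∃ (d : ℤ) (s : 𝟙_ K ⟶ x⟦d⟧), P ∈ invLocus s

section Family

variable {ι : Type} (x : ι → K)

/-- The submonoid `M` of the Picard group generated by the `x i` and the shifts of the unit (as a
property of objects, closed under isomorphisms). -/
inductive PicMonoid : K → Prop
  | of (i : ι) : PicMonoid (x i)
  | shift (d : ℤ) : PicMonoid ((𝟙_ K)⟦d⟧)
  | tensor {a b : K} : PicMonoid a → PicMonoid b → PicMonoid (a ⊗ b)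
  | iso {a b : K} : (a ≅ b) → PicMonoid a → PicMonoid b

/-- The family `x` is ample: the sets `U(s)`, where `s : 𝟙 ⟶ m` runs through the global sections of
all objects `m` of `M`, form a basis for the topology of the spectrum. -/
def IsAmple : Prop :=
  TopologicalSpace.IsTopologicalBasis
    {U : Set (Spectrum K) | ∃ (m : K) (_ : PicMonoid x m) (s : 𝟙_ K ⟶ m), U = invLocus s}

/-! ## The central 2-ring of `M` and its spectrum -/

/-- The objects of the group completion of `M`: all `m ⊗ n⁻¹` with `m` and `n` in `M`. -/
def PicGroup (g : K) : Prop :=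
  ∃ m n : K, PicMonoid x m ∧ PicMonoid x n ∧ Nonempty (g ⊗ n ≅ m)

/-- The morphisms of the `M`-graded central 2-ring `R_M`: its objects are those of the group
completion of `M`, and the morphisms from `g` to `h` are all morphisms of `K` if `h ≅ m ⊗ g` for some
`m` in `M`, and only `0` otherwise. -/
def centralRing : MorphismProperty K :=
  fun g h f => PicGroup x g ∧ PicGroup x h ∧
    ((∃ m : K, PicMonoid x m ∧ Nonempty (h ≅ m ⊗ g)) ∨ f = 0)

/-- The homogeneous prime ideals of `R_M`, that is, the points of the spectrum of `R_M`. -/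
@[ext]
structure CentralPrime where
  carrier : MorphismProperty K
  le_centralRing : carrier ≤ centralRing x
  zero_mem (g h : K) : PicGroup x g → PicGroup x h → carrier (0 : g ⟶ h)
  add_mem {g h : K} (r r' : g ⟶ h) : carrier r → carrier r' → carrier (r + r')
  comp_mem {g h k : K} (r : g ⟶ h) (t : h ⟶ k) : carrier r → centralRing x t → carrier (r ≫ t)
  mem_comp {g h k : K} (t : g ⟶ h) (r : h ⟶ k) : centralRing x t → carrier r → carrier (t ≫ r)
  whiskerLeft_mem (k : K) {g h : K} (r : g ⟶ h) : PicGroup x k → carrier r → carrier (k ◁ r)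
  whiskerRight_mem {g h : K} (r : g ⟶ h) (k : K) : PicGroup x k → carrier r → carrier (r ▷ k)
  ne_top : carrier ≠ centralRing x
  mem_or_mem {g h k : K} (r : g ⟶ h) (s : h ⟶ k) : centralRing x r → centralRing x s →
    carrier (r ≫ s) → carrier r ∨ carrier s

/-! ## The graded scheme `P{x i}` -/

/-- A choice of a global section `s i` of some degree of every `x i`; it gives a chart of the graded
scheme `P{x i}`. -/
structure Chart where
  deg : ι → ℤ
  sec (i : ι) : 𝟙_ K ⟶ (x i)⟦deg i⟧

variable {x}

/-- The domain `⋂ i, D(s i)` of the chart, an open subset of the spectrum of `R_M`. -/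
def Chart.domain (s : Chart x) : Set (CentralPrime x) :=
  {𝔭 | ∀ i, ¬ 𝔭.carrier (s.sec i)}

/-- The tt-ideal of `K` generated by the cones of the sections `s i`. -/
def Chart.ideal (s : Chart x) : ThickIdeal K :=
  ThickIdeal.generatedBy fun c => ∃ (i : ι) (f : (x i)⟦s.deg i⟧ ⟶ c) (g : c ⟶ (𝟙_ K)⟦(1 : ℤ)⟧),
    Triangle.mk (s.sec i) f g ∈ distTriang K

/-- The degree `d` part of the graded ring of the chart, which is the graded endomorphism ring
`Hom(Σᵈ 𝟙, 𝟙)` of the unit of the tt-category `K[s⁻¹] = K / ⟨cone (s i)⟩`. The domain of the chart is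
identified with the homogeneous spectrum of this graded ring. -/
abbrev Chart.ring (s : Chart x) : ℤ → Type _ := GEnd s.ideal.unit

/-- The homogeneous ideal of the ring of the chart which corresponds to a point `𝔭` of the domain: it
is the extension of `𝔭` along `R_M ⟶ K[s⁻¹]`, generated by the fractions `b ∘ t⁻¹ : Σᵈ 𝟙 ⟶ 𝟙` with
`b` in `𝔭` and with a morphism `t` of `R_M` which becomes invertible in `K[s⁻¹]`. -/
def Chart.primeAt (s : Chart x) (𝔭 : CentralPrime x) : Ideal (Total s.ring) :=
  Ideal.span {r | ∃ (d : ℤ) (a : s.ideal.carrier.trW.Q.obj ((𝟙_ K)⟦d⟧) ⟶ s.ideal.unit)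
    (k : K) (t : k ⟶ (𝟙_ K)⟦d⟧) (b : k ⟶ 𝟙_ K),
      centralRing x t ∧ s.ideal.carrier.trW t ∧ 𝔭.carrier b ∧
      s.ideal.carrier.trW.Q.map t ≫ a = s.ideal.carrier.trW.Q.map b ∧
      r = hom (A := s.ring)
        ((s.ideal.carrier.trW.Q.commShiftIso d).inv.app (𝟙_ K) ≫ a)}

/-- The period at a point `𝔭` of the chart, that is, the period of the local graded ring of `P{x i}` at
`𝔭`, computed in the chart. -/
def Chart.periodAt (s : Chart x) (𝔭 : CentralPrime x) : ℕ := ringPeriodAt (s.primeAt 𝔭)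

variable (x)

/-- The points of the graded scheme `P{x i}`: the union of the domains of all charts. -/
def gradedSchemeP : Set (CentralPrime x) := ⋃ s : Chart x, s.domain

end Family
end Spectrum
end TTPeriod

end

open TTPeriod

/-!
The endomorphisms of the unit of `K / P` form a graded local ring: the cone of a morphism `s` from
the unit to an invertible object is annihilated by `s ⊗ s`, and in `K / P` a tensor product vanishes
only if one of its factors does. An ample family of invertible objects clears denominators, so that
every isomorphism `Σᵈ 𝟙 ≅ 𝟙` of `K / P` is a fraction `b ∘ t⁻¹`, where `t` and `b` have a common
source in the group generated by the family and the shifts of the unit. In a chart the members of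
the family are shifts of the unit, hence `b` and `t` become homogeneous elements outside of the
prime whose degrees differ by `d`, and their quotient is a unit of degree `d` of the local graded
ring. Conversely, homogeneous units of that ring become isomorphisms in `K / P`. If the comparison
map is a homeomorphism onto its image, then the empty family is ample and the same argument applies
to `K` itself.
-/

noncomputable section

namespace TTPeriod

section Monoidal

variable {C : Type u} [Category.{v} C] [MonoidalCategory C]

/-- The natural morphism `X ⟶ m ⊗ X` given by a section `s` of `m`. -/
def act {m : C} (s : 𝟙_ C ⟶ m) (X : C) : X ⟶ m ⊗ X := (λ_ X).inv ≫ s ▷ X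

theorem act_naturality {m : C} (s : 𝟙_ C ⟶ m) {X Y : C} (f : X ⟶ Y) :
    act s X ≫ m ◁ f = f ≫ act s Y := by
  simp [act, ← whisker_exchange]

theorem act_tensor {m : C} (s : 𝟙_ C ⟶ m) (X Y : C) :
    act s (X ⊗ Y) = act s X ▷ Y ≫ (α_ m X Y).hom := by
  simp [act]

theorem act_unit {m : C} (s : 𝟙_ C ⟶ m) : act s (𝟙_ C) = s ≫ (ρ_ m).inv := by
  simp [act, unitors_inv_equal]

theorem act_comp_act {m n : C} (t : 𝟙_ C ⟶ n) (s : 𝟙_ C ⟶ m) (X : C) :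
    act (t ≫ act s n) X = act t X ≫ act s (n ⊗ X) ≫ (α_ m n X).inv := by
  simp [act]

section Annihilation

variable [Preadditive C]

theorem act_eq_zero_of_retract {m X Y : C} {s : 𝟙_ C ⟶ m} (r : Retract X Y)
    (h : act s Y = 0) : act s X = 0 :=
  calc act s X = r.i ≫ act s Y ≫ m ◁ r.r := by rw [act_naturality, r.retract_assoc]
    _ = 0 := by rw [h, zero_comp, comp_zero]

theorem act_eq_zero_of_iso {m X Y : C} {s : 𝟙_ C ⟶ m} (e : X ≅ Y) (h : act s X = 0) :
    act s Y = 0 :=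
  act_eq_zero_of_retract e.symm.retract h

theorem act_tensor_eq_zero_of_left [MonoidalPreadditive C] {m X : C} {s : 𝟙_ C ⟶ m}
    (h : act s X = 0) (Y : C) : act s (X ⊗ Y) = 0 := by
  rw [act_tensor, h, MonoidalPreadditive.zero_whiskerRight, zero_comp]

theorem act_tensor_eq_zero_of_right [MonoidalPreadditive C] [BraidedCategory C] {m Y : C}
    {s : 𝟙_ C ⟶ m} (h : act s Y = 0) (X : C) : act s (X ⊗ Y) = 0 :=
  act_eq_zero_of_iso (β_ _ _) (act_tensor_eq_zero_of_left h X)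

end Annihilation

/-- The natural endomorphism of `X` given by an endomorphism of the unit. -/
def scalar (e : 𝟙_ C ⟶ 𝟙_ C) (X : C) : X ⟶ X := act e X ≫ (λ_ X).hom

theorem scalar_naturality (e : 𝟙_ C ⟶ 𝟙_ C) {X Y : C} (f : X ⟶ Y) :
    scalar e X ≫ f = f ≫ scalar e Y := by
  simp [scalar, ← reassoc_of% act_naturality]

theorem scalar_id (X : C) : scalar (𝟙 (𝟙_ C)) X = 𝟙 X := by
  simp [scalar, act]

theorem scalar_tensor (e : 𝟙_ C ⟶ 𝟙_ C) (X Y : C) : scalar e (X ⊗ Y) = scalar e X ▷ Y := by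
  simp [scalar, act]

theorem scalar_add [Preadditive C] [MonoidalPreadditive C] (a b : 𝟙_ C ⟶ 𝟙_ C) (X : C) :
    scalar (a + b) X = scalar a X + scalar b X := by
  simp [scalar, act]

instance (e : 𝟙_ C ⟶ 𝟙_ C) [IsIso e] (X : C) : IsIso (scalar e X) := by
  unfold scalar act
  infer_instance

/-- An object with a tensor inverse. -/
def IsInvertible (u : C) : Prop := ∃ u' : C, Nonempty (u ⊗ u' ≅ 𝟙_ C)

namespace IsInvertible

theorem unit : IsInvertible (𝟙_ C) := ⟨𝟙_ C, ⟨λ_ _⟩⟩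

theorem of_iso {u w : C} (e : u ≅ w) (h : IsInvertible u) : IsInvertible w := by
  obtain ⟨u', ⟨i⟩⟩ := h
  exact ⟨u', ⟨(whiskerRightIso e u').symm ≪≫ i⟩⟩

theorem tensor {u w : C} (hu : IsInvertible u) (hw : IsInvertible w) : IsInvertible (u ⊗ w) := by
  obtain ⟨u', ⟨i⟩⟩ := hu
  obtain ⟨w', ⟨j⟩⟩ := hw
  exact ⟨w' ⊗ u', ⟨α_ _ _ _ ≪≫ whiskerLeftIso u ((α_ _ _ _).symm ≪≫ whiskerRightIso j u' ≪≫
    λ_ _) ≪≫ i⟩⟩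

theorem map {D : Type*} [Category* D] [MonoidalCategory D] (F : C ⥤ D) [F.Monoidal] {u : C}
    (hu : IsInvertible u) : IsInvertible (F.obj u) := by
  obtain ⟨u', ⟨i⟩⟩ := hu
  exact ⟨F.obj u', ⟨Functor.Monoidal.μIso F u u' ≪≫ F.mapIso i ≪≫
    (Functor.Monoidal.εIso F).symm⟩⟩

variable [BraidedCategory C]

theorem isEquivalence_tensorRight {u : C} (hu : IsInvertible u) :
    (tensorRight u).IsEquivalence := by
  obtain ⟨u', ⟨i⟩⟩ := hu
  exact Functor.IsEquivalence.mk' (tensorRight u')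
    ((rightUnitorNatIso C).symm ≪≫ (tensoringRight C).mapIso i.symm ≪≫ tensorRightTensor u u')
    ((tensorRightTensor u' u).symm ≪≫ (tensoringRight C).mapIso (β_ u' u ≪≫ i) ≪≫
      rightUnitorNatIso C)

theorem isEquivalence_tensorLeft {u : C} (hu : IsInvertible u) :
    (tensorLeft u).IsEquivalence := by
  have := hu.isEquivalence_tensorRight
  exact Functor.isEquivalence_of_iso (BraidedCategory.tensorLeftIsoTensorRight u).symm

theorem of_isEquivalence_tensorRight (u : C) [(tensorRight u).IsEquivalence] :
    IsInvertible u :=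
  ⟨(tensorRight u).objPreimage (𝟙_ C),
    ⟨β_ _ _ ≪≫ (tensorRight u).objObjPreimageIso (𝟙_ C)⟩⟩

theorem exists_scalar {u : C} (hu : IsInvertible u) (h : u ⟶ u) :
    ∃ e : 𝟙_ C ⟶ 𝟙_ C, scalar e u = h := by
  have := hu.isEquivalence_tensorRight
  obtain ⟨e, he⟩ := (tensorRight u).map_surjective ((λ_ u).hom ≫ h ≫ (λ_ u).inv)
  have he' : e ▷ u = (λ_ u).hom ≫ h ≫ (λ_ u).inv := he
  exact ⟨e, by simp [scalar, act, he']⟩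

theorem eq_id_of_scalar_eq_id {u : C} (hu : IsInvertible u) {e : 𝟙_ C ⟶ 𝟙_ C}
    (h : scalar e u = 𝟙 u) : e = 𝟙 _ := by
  have := hu.isEquivalence_tensorRight
  have he : e ▷ u = (λ_ u).hom ≫ scalar e u ≫ (λ_ u).inv := by simp [scalar, act]
  exact (tensorRight u).map_injective (by simp [he, h])

theorem comp_eq_id {u w : C} (hu : IsInvertible u) (hw : IsInvertible w) {f : u ⟶ w} {g : w ⟶ u}
    (h : g ≫ f = 𝟙 w) : f ≫ g = 𝟙 u := by
  obtain ⟨e, he⟩ := hu.exists_scalar (f ≫ g)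
  have hg : scalar e w ≫ g = g := by rw [scalar_naturality, he, reassoc_of% h]
  have hw' : scalar e w = 𝟙 w := by simpa [h] using congrArg (· ≫ f) hg
  rw [← he, hw.eq_id_of_scalar_eq_id hw', scalar_id]

theorem isIso_of_comp {u w z : C} (hu : IsInvertible u) (hw : IsInvertible w)
    (hz : IsInvertible z) (f : u ⟶ w) (g : w ⟶ z) [IsIso (f ≫ g)] : IsIso f ∧ IsIso g := by
  have hg : (inv (f ≫ g) ≫ f) ≫ g = 𝟙 z := by simp
  have hf : f ≫ g ≫ inv (f ≫ g) = 𝟙 u := by rw [← Category.assoc]; exact IsIso.hom_inv_id _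
  exact ⟨⟨_, hf, hw.comp_eq_id hu hf⟩, ⟨_, hw.comp_eq_id hz hg, hg⟩⟩

theorem comp_act_eq_zero [Preadditive C] [MonoidalPreadditive C] {m Z : C}
    (hm : IsInvertible m) (s : 𝟙_ C ⟶ m) {g : m ⟶ Z} (h : s ≫ g = 0) : g ≫ act s Z = 0 := by
  -- Since the braiding of `m ⊗ m` is a scalar, `s ⊗ m` vanishes wherever `m ⊗ s` does.
  obtain ⟨e, he⟩ := (hm.tensor hm).exists_scalar (β_ m m).hom
  have hs : act s m = (ρ_ m).inv ≫ m ◁ s ≫ scalar e (m ⊗ m) := by simp [act, he]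
  calc g ≫ act s Z = act s m ≫ m ◁ g := (act_naturality s g).symm
    _ = (ρ_ m).inv ≫ m ◁ (s ≫ g) ≫ scalar e (m ⊗ Z) := by simp [hs, scalar_naturality]
    _ = 0 := by simp [h]

end IsInvertible

end Monoidal

section Shift

variable {C : Type u} [Category.{v} C] [HasShift C ℤ] [MonoidalCategory C]

theorem comp_act_shift_unit_eq_zero [Preadditive C] {S : C}
    (Φ : tensorRight S ≅ shiftFunctor C (1 : ℤ)) {m Z : C} {s : 𝟙_ C ⟶ m} {δ : Z ⟶ (𝟙_ C)⟦(1 : ℤ)⟧}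
    (h : δ ≫ s⟦(1 : ℤ)⟧' = 0) : δ ≫ act s ((𝟙_ C)⟦(1 : ℤ)⟧) = 0 := by
  have hΦ : (act s (𝟙_ C))⟦(1 : ℤ)⟧' ≫ Φ.inv.app _ = Φ.inv.app (𝟙_ C) ≫ act s (𝟙_ C) ▷ S :=
    Φ.inv.naturality (act s (𝟙_ C))
  have hs : act s ((𝟙_ C)⟦(1 : ℤ)⟧) ≫ m ◁ Φ.inv.app (𝟙_ C) =
      s⟦(1 : ℤ)⟧' ≫ ((ρ_ m).inv)⟦(1 : ℤ)⟧' ≫ Φ.inv.app _ ≫ (α_ m (𝟙_ C) S).hom := by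
    calc act s ((𝟙_ C)⟦(1 : ℤ)⟧) ≫ m ◁ Φ.inv.app (𝟙_ C)
        = Φ.inv.app (𝟙_ C) ≫ act s (𝟙_ C ⊗ S) := act_naturality s _
      _ = _ := by
        rw [act_tensor, ← reassoc_of% hΦ, act_unit, Functor.map_comp, Category.assoc]
  have : IsIso (m ◁ Φ.inv.app (𝟙_ C)) := inferInstance
  rw [← cancel_mono (m ◁ Φ.inv.app (𝟙_ C)), Category.assoc, hs, reassoc_of% h]
  simp only [zero_comp]

variable [BraidedCategory C]

theorem IsInvertible.of_tensorRight_iso_shiftFunctor {S : C} {d : ℤ}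
    (Φ : tensorRight S ≅ shiftFunctor C d) : IsInvertible S := by
  have : (tensorRight S).IsEquivalence := Functor.isEquivalence_of_iso Φ.symm
  exact of_isEquivalence_tensorRight S

theorem IsInvertible.shift {S : C} {d : ℤ} (Φ : tensorRight S ≅ shiftFunctor C d) {u : C}
    (hu : IsInvertible u) : IsInvertible (u⟦d⟧) :=
  (hu.tensor (of_tensorRight_iso_shiftFunctor Φ)).of_iso (Φ.app u)

end Shift

theorem isZero_of_add_eq_id {C : Type*} [Category* C] [Preadditive C] {X : C} {f g : X ⟶ X}
    (hf : f ≫ f = 0) (hg : g ≫ g = 0) (h : f + g = 𝟙 X) : IsZero X := by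
  have hfg : f ≫ g = f := by simpa [hf] using congrArg (f ≫ ·) h
  have hf₀ : f = 0 := by rw [← hfg, ← hfg, Category.assoc, hg, comp_zero]
  have hg₁ : g = 𝟙 X := by rw [← h, hf₀, zero_add]
  rw [IsZero.iff_id_eq_zero, ← hg, hg₁, Category.comp_id]

section Cones

variable {C : Type u} [Category.{v} C] [HasZeroObject C] [HasShift C ℤ] [Preadditive C]
  [∀ n : ℤ, (shiftFunctor C n).Additive] [Pretriangulated C] [MonoidalCategory C]
  [MonoidalPreadditive C] [BraidedCategory C] {S : C} (Φ : tensorRight S ≅ shiftFunctor C (1 : ℤ))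

include Φ

theorem act_comp_act_cone_eq_zero {m Z : C} (hm : IsInvertible m) {s : 𝟙_ C ⟶ m} {g : m ⟶ Z}
    {δ : Z ⟶ (𝟙_ C)⟦(1 : ℤ)⟧} (hT : Triangle.mk s g δ ∈ distTriang C) :
    act s Z ≫ act s (m ⊗ Z) = 0 := by
  obtain ⟨h, hh⟩ : ∃ h : (𝟙_ C)⟦(1 : ℤ)⟧ ⟶ m ⊗ Z, act s Z = δ ≫ h :=
    Triangle.yoneda_exact₃ _ hT _ (hm.comp_act_eq_zero s (comp_distTriang_mor_zero₁₂ _ hT))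
  have hδ : δ ≫ act s ((𝟙_ C)⟦(1 : ℤ)⟧) = 0 :=
    comp_act_shift_unit_eq_zero Φ (comp_distTriang_mor_zero₃₁ _ hT)
  calc act s Z ≫ act s (m ⊗ Z) = (δ ≫ act s ((𝟙_ C)⟦(1 : ℤ)⟧)) ≫ m ◁ h := by
        rw [hh, Category.assoc, Category.assoc, act_naturality]
    _ = 0 := by rw [hδ, zero_comp]

theorem scalar_comp_scalar_cone_eq_zero {Z : C} {a : 𝟙_ C ⟶ 𝟙_ C} {g : 𝟙_ C ⟶ Z}
    {δ : Z ⟶ (𝟙_ C)⟦(1 : ℤ)⟧} (hT : Triangle.mk a g δ ∈ distTriang C) :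
    scalar a Z ≫ scalar a Z = 0 := by
  have h : (λ_ Z).hom ≫ act a Z = act a (𝟙_ C ⊗ Z) ≫ 𝟙_ C ◁ (λ_ Z).hom :=
    (act_naturality a _).symm
  simp only [scalar, Category.assoc]
  rw [reassoc_of% h, reassoc_of% act_comp_act_cone_eq_zero Φ IsInvertible.unit hT, zero_comp]

theorem isIso_or_isIso_of_add_eq_id (hC : ∀ X Y : C, IsZero (X ⊗ Y) → IsZero X ∨ IsZero Y)
    {a b : 𝟙_ C ⟶ 𝟙_ C} (hab : a + b = 𝟙 _) : IsIso a ∨ IsIso b := by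
  obtain ⟨A, g, δ, hA⟩ := distinguished_cocone_triangle a
  obtain ⟨B, g', δ', hB⟩ := distinguished_cocone_triangle b
  have ha : scalar a (A ⊗ B) ≫ scalar a (A ⊗ B) = 0 := by
    rw [scalar_tensor, ← MonoidalCategory.comp_whiskerRight,
      scalar_comp_scalar_cone_eq_zero Φ hA, MonoidalPreadditive.zero_whiskerRight]
  have hb : scalar b (A ⊗ B) ≫ scalar b (A ⊗ B) = 0 := by
    rw [← cancel_epi (β_ B A).hom, ← reassoc_of% scalar_naturality, ← scalar_naturality,
      scalar_tensor, ← MonoidalCategory.comp_whiskerRight_assoc,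
      scalar_comp_scalar_cone_eq_zero Φ hB]
    simp
  have h₀ : IsZero (A ⊗ B) := isZero_of_add_eq_id ha hb (by rw [← scalar_add, hab, scalar_id])
  exact (hC _ _ h₀).imp (Triangle.isZero₃_iff_isIso₁ _ hA).1 (Triangle.isZero₃_iff_isIso₁ _ hB).1

theorem IsInvertible.isIso_or_isIso_of_isIso_add
    (hC : ∀ X Y : C, IsZero (X ⊗ Y) → IsZero X ∨ IsZero Y) {u w : C} (hu : IsInvertible u)
    (a b : u ⟶ w) [IsIso (a + b)] : IsIso a ∨ IsIso b := by
  obtain ⟨e, he⟩ := hu.exists_scalar (a ≫ inv (a + b))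
  obtain ⟨f, hf⟩ := hu.exists_scalar (b ≫ inv (a + b))
  have hef : e + f = 𝟙 _ := hu.eq_id_of_scalar_eq_id (by
    rw [scalar_add, he, hf, ← Preadditive.add_comp, IsIso.hom_inv_id])
  have isIso_of_scalar {c : u ⟶ w} {e : 𝟙_ C ⟶ 𝟙_ C} (he : scalar e u = c ≫ inv (a + b))
      (_ : IsIso e) : IsIso c := by
    have : IsIso (c ≫ inv (a + b)) := by rw [← he]; infer_instance
    exact IsIso.of_isIso_comp_right c (inv (a + b))
  exact (isIso_or_isIso_of_add_eq_id Φ hC hef).imp (isIso_of_scalar he) (isIso_of_scalar hf)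

end Cones

section ThickIdeals

variable {K : Type u} [Category.{v} K] [HasZeroObject K] [HasShift K ℤ]
  [Preadditive K] [∀ n : ℤ, (shiftFunctor K n).Additive] [Pretriangulated K]
  [MonoidalCategory K]

namespace ThickIdeal

instance : PartialOrder (ThickIdeal K) :=
  PartialOrder.lift ThickIdeal.carrier fun _ _ => ThickIdeal.ext

theorem generatedBy_le_iff {S : ObjectProperty K} {I : ThickIdeal K} :
    generatedBy S ≤ I ↔ S ≤ I.carrier :=
  ⟨fun h c hc => h c fun _ hJ => hJ c hc, fun h _ hc => hc I h⟩

/-- The union of a directed family of tt-ideals. -/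
def directedUnion {α : Type*} [Nonempty α] (I : α → ThickIdeal K) (hI : Directed (· ≤ ·) I) :
    ThickIdeal K where
  carrier X := ∃ a, (I a).carrier X
  isTriangulated :=
    { exists_zero := ⟨_, isZero_zero K, Classical.arbitrary α, (I _).carrier.prop_zero⟩
      isStableUnderShiftBy := fun n => ⟨fun _ ⟨a, hX⟩ => ⟨a, (I a).carrier.le_shift n _ hX⟩⟩
      ext₂' := by
        rintro T hT ⟨a, h₁⟩ ⟨b, h₃⟩
        obtain ⟨c, hac, hbc⟩ := hI a b
        exact ObjectProperty.le_isoClosure _ _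
          ⟨c, (I c).carrier.ext_of_isTriangulatedClosed₂ T hT (hac _ h₁) (hbc _ h₃)⟩ }
  isClosedUnderIsomorphisms := ⟨fun e ⟨a, hX⟩ => ⟨a, (I a).carrier.prop_of_iso e hX⟩⟩
  isStableUnderRetracts := ⟨fun r ⟨a, hX⟩ => ⟨a, (I a).carrier.prop_of_retract r hX⟩⟩
  tensor_mem b X := fun ⟨a, hX⟩ => ⟨a, (I a).tensor_mem b X hX⟩

/-- The tt-ideal generated by the cones of a family of morphisms, so that the Verdier quotient by it
is the localization of `K` as a tt-category at that family. -/
def coneIdeal {α : Type*} {a b : α → K} (s : ∀ j, a j ⟶ b j) : ThickIdeal K :=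
  generatedBy fun c => ∃ (j : α) (f : b j ⟶ c) (g : c ⟶ (a j)⟦(1 : ℤ)⟧),
    Triangle.mk (s j) f g ∈ distTriang K

theorem coneIdeal_le_iff {α : Type*} {a b : α → K} {s : ∀ j, a j ⟶ b j} {I : ThickIdeal K} :
    coneIdeal s ≤ I ↔ ∀ j, I.carrier.trW (s j) := by
  refine generatedBy_le_iff.trans ⟨fun h j => ?_, ?_⟩
  · obtain ⟨Z, f, g, hT⟩ := distinguished_cocone_triangle (s j)
    exact ⟨Z, f, g, hT, h Z ⟨j, f, g, hT⟩⟩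
  · rintro h c ⟨j, f, g, hT⟩
    exact (I.carrier.trW_iff_of_distinguished _ hT).1 (h j)

theorem trW_coneIdeal {α : Type*} {a b : α → K} (s : ∀ j, a j ⟶ b j) (j : α) :
    (coneIdeal s).carrier.trW (s j) :=
  coneIdeal_le_iff.1 le_rfl j

theorem mem_of_mem_tensor_self [BraidedCategory K] (I : ThickIdeal K) {c d : K} [ExactPairing c d]
    (h : I.carrier (c ⊗ c)) : I.carrier c := by
  have hr : Retract c ((c ⊗ d) ⊗ c) :=
    { i := (λ_ c).inv ≫ η_ c d ▷ c
      r := (α_ c d c).hom ≫ c ◁ ε_ c d ≫ (ρ_ c).hom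
      retract := by simp [reassoc_of% ExactPairing.evaluation_coevaluation c d] }
  exact I.carrier.prop_of_retract hr (I.carrier.prop_of_iso
    ((α_ _ _ _).symm ≪≫ whiskerRightIso (β_ d c) c) (I.tensor_mem d _ h))

end ThickIdeal

end ThickIdeals

section TensorTriangulated

variable {K : Type u} [Category.{v} K] [HasZeroObject K] [HasShift K ℤ]
  [Preadditive K] [∀ n : ℤ, (shiftFunctor K n).Additive] [Pretriangulated K]
  [MonoidalCategory K] [SymmetricCategory K] [TensorTriangulated K]

instance : MonoidalPreadditive K where
  whiskerLeft_zero {X _ _} := (tensorLeft X).map_zero _ _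
  zero_whiskerRight {X Y Z} := by
    have h : X ◁ (0 : Y ⟶ Z) = 0 := (tensorLeft X).map_zero _ _
    rw [← cancel_mono (β_ Z X).hom, BraidedCategory.braiding_naturality_left, h, comp_zero,
      zero_comp]
  whiskerLeft_add {X _ _} _ _ := (tensorLeft X).map_add
  add_whiskerRight {X Y Z} f g := by
    have h : X ◁ (f + g) = X ◁ f + X ◁ g := (tensorLeft X).map_add
    rw [← cancel_mono (β_ Z X).hom, BraidedCategory.braiding_naturality_left, h]
    simp

/-- Tensoring with a shift of the unit is shifting. -/
def tensorRightShiftUnit (d : ℤ) : tensorRight ((𝟙_ K)⟦d⟧) ≅ shiftFunctor K d :=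
  NatIso.ofComponents
    (fun a => ((tensorLeft a).commShiftIso d).app (𝟙_ K) ≪≫ (shiftFunctor K d).mapIso (ρ_ a))
    (fun {a b} f => by
      have h := TensorTriangulated.natural f (𝟙_ K) d
      dsimp at h ⊢
      rw [reassoc_of% h, Category.assoc, ← Functor.map_comp, ← Functor.map_comp,
        MonoidalCategory.rightUnitor_naturality])

namespace ThickIdeal

variable (I : ThickIdeal K)

instance : I.carrier.trW.IsMonoidal := by
  have whiskerLeft_mem (X : K) {Y Z : K} (f : Y ⟶ Z) (hf : I.carrier.trW f) :
      I.carrier.trW (X ◁ f) := by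
    obtain ⟨c, g, δ, hT, hc⟩ := hf
    exact ObjectProperty.trW.mk I.carrier ((tensorLeft X).map_distinguished _ hT)
      (I.tensor_mem X c hc)
  exact
    { whiskerLeft := fun X _ _ f hf => whiskerLeft_mem X f hf
      whiskerRight := fun f hf X => (I.carrier.trW.arrow_mk_iso_iff
        (Arrow.isoMk (β_ _ X) (β_ _ X) (by simp))).2 (whiskerLeft_mem X f hf) }

theorem trW_act {m : K} {s : 𝟙_ K ⟶ m} (hs : I.carrier.trW s) (X : K) :
    I.carrier.trW (act s X) :=
  MorphismProperty.RespectsIso.precomp _ _ _ (I.carrier.trW.whiskerRight_mem s hs X)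

variable {I} in
theorem trW_whiskerLeft_iff {k : K} (hk : IsInvertible k) {X Y : K} {f : X ⟶ Y} :
    I.carrier.trW (k ◁ f) ↔ I.carrier.trW f := by
  refine ⟨fun h => ?_, I.carrier.trW.whiskerLeft_mem k f⟩
  obtain ⟨k', ⟨i⟩⟩ := hk
  have e : tensorLeft k ⋙ tensorLeft k' ≅ 𝟭 K :=
    (tensorLeftTensor k' k).symm ≪≫ (tensoringLeft K).mapIso (β_ k' k ≪≫ i) ≪≫ leftUnitorNatIso K
  exact (I.carrier.trW.arrow_mk_iso_iff (Arrow.isoOfNatIso e (Arrow.mk f))).1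
    (I.carrier.trW.whiskerLeft_mem k' _ h)

variable {I} in
theorem trW_whiskerRight_iff {k : K} (hk : IsInvertible k) {X Y : K} {f : X ⟶ Y} :
    I.carrier.trW (f ▷ k) ↔ I.carrier.trW f :=
  (I.carrier.trW.arrow_mk_iso_iff (Arrow.isoMk (β_ X k) (β_ Y k) (by simp))).trans
    (trW_whiskerLeft_iff hk)

/-- The tt-ideal of the objects `x` with `b ⊗ x` in `I`. -/
def colon (b : K) : ThickIdeal K where
  carrier := I.carrier.inverseImage (tensorLeft b)
  isTriangulated := inferInstance
  isClosedUnderIsomorphisms := inferInstance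
  isStableUnderRetracts := ⟨fun r h => I.carrier.prop_of_retract (r.map (tensorLeft b)) h⟩
  tensor_mem a x h := I.carrier.prop_of_iso
    ((α_ _ _ _).symm ≪≫ whiskerRightIso (β_ a b) x ≪≫ α_ _ _ _) (I.tensor_mem a _ h)

theorem le_colon (b : K) : I ≤ I.colon b := fun x hx => I.tensor_mem b x hx

variable {I} in
theorem mem_or_mem_of_maximal (hK : IsRigid K) {c : K}
    (hI : Maximal (fun J : ThickIdeal K => ¬ J.carrier c) I) {a b : K} (hab : I.carrier (a ⊗ b)) :
    I.carrier a ∨ I.carrier b := by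
  have tensor_mem_of_notMem {x y : K} (hxy : I.carrier (x ⊗ y)) (hy : ¬ I.carrier y) :
      I.carrier (x ⊗ c) := by
    by_contra hxc
    exact hy (hI.2 (y := I.colon x) hxc (I.le_colon x) _ hxy)
  by_contra! h
  have hca := I.carrier.prop_of_iso (β_ a c) (tensor_mem_of_notMem hab h.2)
  obtain ⟨d, ⟨_⟩⟩ := hK c
  exact hI.1 (I.mem_of_mem_tensor_self (d := d) (tensor_mem_of_notMem hca h.1))

theorem exists_spectrum_notMem (hK : IsRigid K) {c : K} (hc : ¬ I.carrier c) :
    ∃ P : Spectrum K, I ≤ P.toThickIdeal ∧ ¬ P.carrier c := by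
  obtain ⟨J, hIJ, hJ⟩ := zorn_le_nonempty₀ {J : ThickIdeal K | ¬ J.carrier c}
    (fun C hC hchain J hJ => by
      have : Nonempty C := ⟨⟨J, hJ⟩⟩
      exact ⟨directedUnion Subtype.val (directedOn_iff_directed.1 hchain.directedOn),
        fun ⟨⟨_, hJ'⟩, h⟩ => hC hJ' h, fun J' hJ' _ hX => ⟨⟨J', hJ'⟩, hX⟩⟩) I hc
  refine ⟨{ J with
    unit_notMem := fun h => hJ.1 (J.carrier.prop_of_iso (ρ_ c) (J.tensor_mem c _ h))
    mem_or_mem := fun _ _ => mem_or_mem_of_maximal hK hJ }, hIJ, hJ.1⟩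

theorem mem_of_forall_spectrum (hK : IsRigid K) {c : K}
    (h : ∀ P : Spectrum K, I ≤ P.toThickIdeal → P.carrier c) : I.carrier c := by
  by_contra hc
  obtain ⟨P, hIP, hP⟩ := I.exists_spectrum_notMem hK hc
  exact hP (h P hIP)

end ThickIdeal

section Killed

theorem exists_act_eq_comp_whiskerLeft {T : Triangle K} (hT : T ∈ distTriang K) {n : K}
    {t : 𝟙_ K ⟶ n} (h : act t T.obj₃ = 0) :
    ∃ y : T.obj₂ ⟶ n ⊗ T.obj₁, act t T.obj₂ = y ≫ n ◁ T.mor₁ :=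
  Triangle.coyoneda_exact₂ _ ((tensorLeft n).map_distinguished _ hT) (act t T.obj₂)
    ((act_naturality t T.mor₂).trans (by rw [h]; exact comp_zero))

theorem act_comp_eq_zero_of_distTriang {T : Triangle K} (hT : T ∈ distTriang K) {m n : K}
    {s : 𝟙_ K ⟶ m} {t : 𝟙_ K ⟶ n} (h₁ : act s T.obj₁ = 0) (h₃ : act t T.obj₃ = 0) :
    act (t ≫ act s n) T.obj₂ = 0 := by
  obtain ⟨y, hy⟩ := exists_act_eq_comp_whiskerLeft hT h₃
  rw [act_comp_act, hy, Category.assoc, ← reassoc_of% act_naturality,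
    reassoc_of% act_tensor_eq_zero_of_right h₁ n, zero_comp, comp_zero]

variable (M : ObjectProperty K) [M.IsMonoidal]

/-- The tt-ideal of the objects annihilated by some section, of an object of `M`, which is
invertible modulo `I`. -/
def ThickIdeal.killed (I : ThickIdeal K) : ThickIdeal K where
  carrier X := ∃ (m : K) (s : 𝟙_ K ⟶ m), M m ∧ I.carrier.trW s ∧ act s X = 0
  isTriangulated :=
    { exists_zero := ⟨_, isZero_zero K, 𝟙_ K, 𝟙 _, M.prop_unit, MorphismProperty.id_mem _ _,
        (isZero_zero K).eq_of_src _ _⟩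
      isStableUnderShiftBy := fun n => ⟨fun X ⟨m, s, hm, hs, h⟩ => ⟨m, s, hm, hs,
        act_eq_zero_of_iso ((tensorRightShiftUnit n).app X) (act_tensor_eq_zero_of_left h _)⟩⟩
      ext₂' := by
        rintro T hT ⟨m, s, hm, hs, h₁⟩ ⟨n, t, hn, ht, h₃⟩
        exact ObjectProperty.le_isoClosure _ _ ⟨m ⊗ n, t ≫ act s n, M.prop_tensor hm hn,
          MorphismProperty.comp_mem _ _ _ ht (I.trW_act hs n),
          act_comp_eq_zero_of_distTriang hT h₁ h₃⟩ }
  isClosedUnderIsomorphisms :=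
    ⟨fun e ⟨m, s, hm, hs, h⟩ => ⟨m, s, hm, hs, act_eq_zero_of_iso e h⟩⟩
  isStableUnderRetracts :=
    ⟨fun r ⟨m, s, hm, hs, h⟩ => ⟨m, s, hm, hs, act_eq_zero_of_retract r h⟩⟩
  tensor_mem a _ := fun ⟨m, s, hm, hs, h⟩ => ⟨m, s, hm, hs, act_tensor_eq_zero_of_right h a⟩

variable {M}

theorem ThickIdeal.killed_mono {I J : ThickIdeal K} (hIJ : I ≤ J) : I.killed M ≤ J.killed M :=
  fun _ ⟨m, s, hm, hs, h⟩ => ⟨m, s, hm, ObjectProperty.trW_monotone hIJ _ hs, h⟩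

theorem ThickIdeal.coneIdeal_le_killed (hM : ∀ m, M m → IsInvertible m) {α : Type*} {m : α → K}
    (hm : ∀ j, M (m j)) (s : ∀ j, 𝟙_ K ⟶ m j) : coneIdeal s ≤ (coneIdeal s).killed M := by
  refine generatedBy_le_iff.2 ?_
  rintro c ⟨j, f, g, hT⟩
  have hs := trW_coneIdeal s j
  refine ⟨m j ⊗ m j, s j ≫ act (s j) (m j), M.prop_tensor (hm j) (hm j),
    MorphismProperty.comp_mem _ _ _ hs (trW_act _ hs (m j)), ?_⟩
  rw [act_comp_act,
    reassoc_of% act_comp_act_cone_eq_zero (tensorRightShiftUnit 1) (hM _ (hm j)) hT, zero_comp]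

theorem ThickIdeal.exists_denominator (hM : ∀ m, M m → IsInvertible m) {I : ThickIdeal K}
    (hI : I ≤ I.killed M) {a c : K} {t : c ⟶ a} (ht : I.carrier.trW t) :
    ∃ (w c' : K) (z : c' ⟶ c), M w ∧ Nonempty (w ⊗ c' ≅ a) ∧ I.carrier.trW (z ≫ t) := by
  obtain ⟨Z, g, δ, hT, hZ⟩ := ht
  obtain ⟨w, s, hw, hs, h⟩ := hI _ hZ
  obtain ⟨y, hy⟩ : ∃ y : a ⟶ w ⊗ c, act s a = y ≫ w ◁ t := exists_act_eq_comp_whiskerLeft hT h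
  have := (hM w hw).isEquivalence_tensorLeft
  let e : w ⊗ (tensorLeft w).objPreimage a ≅ a := (tensorLeft w).objObjPreimageIso a
  obtain ⟨z, hz⟩ := (tensorLeft w).map_surjective (e.hom ≫ y)
  have hz' : w ◁ z = e.hom ≫ y := hz
  refine ⟨w, _, z, hw, ⟨e⟩, (trW_whiskerLeft_iff (hM w hw)).1 ?_⟩
  rw [MonoidalCategory.whiskerLeft_comp, hz', Category.assoc, ← hy]
  exact MorphismProperty.RespectsIso.precomp _ _ _ (I.trW_act hs a)

end Killed

end TensorTriangulated

section Quotient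

variable {K : Type u} [Category.{v} K] [HasZeroObject K] [HasShift K ℤ]
  [Preadditive K] [∀ n : ℤ, (shiftFunctor K n).Additive] [Pretriangulated K]
  [MonoidalCategory K]

namespace ThickIdeal

variable (I : ThickIdeal K)

/-- The Verdier quotient functor. -/
abbrev Q : K ⥤ I.Quotient := I.carrier.trW.Q

variable {I}

theorem exists_iso_Q_obj (X : I.Quotient) : ∃ Y : K, Nonempty (I.Q.obj Y ≅ X) :=
  have := Localization.essSurj I.Q I.carrier.trW
  ⟨_, ⟨I.Q.objObjPreimageIso X⟩⟩

variable [IsTriangulated K]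

theorem isZero_Q_iff {X : K} : IsZero (I.Q.obj X) ↔ I.carrier X := by
  rw [IsZero.iff_id_eq_zero, ← I.Q.map_id, ← I.Q.map_zero,
    MorphismProperty.map_eq_iff_precomp I.Q I.carrier.trW]
  constructor
  · rintro ⟨Z, s, ⟨C, g, δ, hT, hC⟩, h⟩
    obtain rfl : s = 0 := by simpa using h
    obtain ⟨r, hr⟩ : ∃ r : C ⟶ X, 𝟙 X = g ≫ r := Triangle.yoneda_exact₂ _ hT (𝟙 X) zero_comp
    exact I.carrier.prop_of_retract ⟨g, r, hr.symm⟩ hC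
  · intro h
    exact ⟨_, _, (I.carrier.trW_iff_of_distinguished _ (contractible_distinguished₁ X)).2 h,
      zero_comp.trans zero_comp.symm⟩

theorem isIso_Q_map_iff {X Y : K} {f : X ⟶ Y} : IsIso (I.Q.map f) ↔ I.carrier.trW f := by
  refine ⟨fun h => ?_, Localization.inverts I.Q I.carrier.trW f⟩
  obtain ⟨Z, g, δ, hT⟩ := distinguished_cocone_triangle f
  exact ⟨Z, g, δ, hT, isZero_Q_iff.1
    ((Triangle.isZero₃_iff_isIso₁ _ (I.Q.map_distinguished _ hT)).2 h)⟩

theorem exists_fraction {X Y : K} (f : I.Q.obj X ⟶ I.Q.obj Y) :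
    ∃ (c : K) (t : c ⟶ X) (b : c ⟶ Y), I.carrier.trW t ∧ I.Q.map t ≫ f = I.Q.map b := by
  obtain ⟨φ, rfl⟩ := Localization.exists_rightFraction I.Q I.carrier.trW f
  exact ⟨φ.X', φ.s, φ.f, φ.hs, φ.map_s_comp_map _ _⟩

end ThickIdeal

end Quotient

section QuotientMonoidal

variable {K : Type u} [Category.{v} K] [HasZeroObject K] [HasShift K ℤ]
  [Preadditive K] [∀ n : ℤ, (shiftFunctor K n).Additive] [Pretriangulated K]
  [MonoidalCategory K] [SymmetricCategory K] [TensorTriangulated K]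

namespace ThickIdeal

variable (I : ThickIdeal K)

instance : MonoidalCategory I.Quotient :=
  inferInstanceAs (MonoidalCategory (LocalizedMonoidal I.carrier.trW.Q I.carrier.trW (Iso.refl _)))

instance : BraidedCategory I.Quotient :=
  inferInstanceAs (BraidedCategory (LocalizedMonoidal I.carrier.trW.Q I.carrier.trW (Iso.refl _)))

instance monoidalQ : I.Q.Monoidal :=
  inferInstanceAs (Localization.Monoidal.toMonoidalCategory I.carrier.trW.Q I.carrier.trW
    (Iso.refl _)).Monoidal

/-- Tensoring with an object of `K` commutes with the Verdier quotient functor. -/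
def tensorRightQ (X : K) : I.Q ⋙ tensorRight (I.Q.obj X) ≅ tensorRight X ⋙ I.Q :=
  NatIso.ofComponents (fun a => Functor.Monoidal.μIso I.Q a X) (fun f => by simp)

theorem additive_tensorRight (X : I.Quotient) : (tensorRight X).Additive := by
  obtain ⟨Y, ⟨e⟩⟩ := exists_iso_Q_obj X
  have hY : (tensorRight Y).Additive := { map_add := by simp }
  have : (tensorRight (I.Q.obj Y)).Additive :=
    (Localization.functor_additive_iff I.Q I.carrier.trW _).2
      (Functor.additive_of_iso (I.tensorRightQ Y).symm)
  exact Functor.additive_of_iso ((tensoringRight _).mapIso e)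

theorem additive_tensorLeft (X : I.Quotient) : (tensorLeft X).Additive :=
  have := I.additive_tensorRight X
  Functor.additive_of_iso (BraidedCategory.tensorLeftIsoTensorRight X).symm

instance : MonoidalPreadditive I.Quotient where
  whiskerLeft_zero {X _ _} := have := I.additive_tensorLeft X; (tensorLeft X).map_zero _ _
  zero_whiskerRight {X _ _} := have := I.additive_tensorRight X; (tensorRight X).map_zero _ _
  whiskerLeft_add {X _ _} _ _ := have := I.additive_tensorLeft X; (tensorLeft X).map_add
  add_whiskerRight {X _ _} _ _ := have := I.additive_tensorRight X; (tensorRight X).map_add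

/-- Tensoring with a shift of the unit is shifting, in the Verdier quotient. -/
def quotientTensorRightShiftUnit (d : ℤ) :
    tensorRight (I.Q.obj ((𝟙_ K)⟦d⟧)) ≅ shiftFunctor I.Quotient d :=
  Localization.liftNatIso I.Q I.carrier.trW
    (I.Q ⋙ tensorRight (I.Q.obj ((𝟙_ K)⟦d⟧))) (I.Q ⋙ shiftFunctor I.Quotient d) _ _
    (I.tensorRightQ _ ≪≫ Functor.isoWhiskerRight (tensorRightShiftUnit d) I.Q ≪≫
      I.Q.commShiftIso d)

variable {I}

theorem trW_and_trW_of_comp {X Y Z : K} (hX : IsInvertible X) (hY : IsInvertible Y)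
    (hZ : IsInvertible Z) {f : X ⟶ Y} {g : Y ⟶ Z} (h : I.carrier.trW (f ≫ g)) :
    I.carrier.trW f ∧ I.carrier.trW g := by
  have : IsIso (I.Q.map f ≫ I.Q.map g) := by rwa [← Functor.map_comp, isIso_Q_map_iff]
  have hfg : IsIso (I.Q.map f) ∧ IsIso (I.Q.map g) :=
    IsInvertible.isIso_of_comp (hX.map I.Q) (hY.map I.Q) (hZ.map I.Q) _ _
  rwa [isIso_Q_map_iff, isIso_Q_map_iff] at hfg

theorem exists_fraction_of_le_killed {M : ObjectProperty K} [M.IsMonoidal]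
    (hM : ∀ m, M m → IsInvertible m) (hI : I ≤ I.killed M) {X Y : K}
    (f : I.Q.obj X ⟶ I.Q.obj Y) :
    ∃ (w c : K) (t : c ⟶ X) (b : c ⟶ Y), M w ∧ Nonempty (w ⊗ c ≅ X) ∧ I.carrier.trW t ∧
      I.Q.map t ≫ f = I.Q.map b := by
  obtain ⟨c, t, b, ht, hb⟩ := exists_fraction f
  obtain ⟨w, c', z, hw, e, hz⟩ := exists_denominator hM hI ht
  exact ⟨w, c', z ≫ t, z ≫ b, hw, e, hz, by simp [hb]⟩

end ThickIdeal

namespace Spectrum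

variable (P : Spectrum K)

theorem isZero_or_isZero (X Y : P.Quotient) (h : IsZero (X ⊗ Y)) : IsZero X ∨ IsZero Y := by
  obtain ⟨A, ⟨a⟩⟩ := ThickIdeal.exists_iso_Q_obj X
  obtain ⟨B, ⟨b⟩⟩ := ThickIdeal.exists_iso_Q_obj Y
  have hAB : IsZero (P.Q.obj (A ⊗ B)) :=
    h.of_iso ((Functor.Monoidal.μIso P.Q A B).symm ≪≫ (a ⊗ᵢ b))
  exact (P.mem_or_mem A B (ThickIdeal.isZero_Q_iff.1 hAB)).imp
    (fun hA => (ThickIdeal.isZero_Q_iff.2 hA).of_iso a.symm)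
    (fun hB => (ThickIdeal.isZero_Q_iff.2 hB).of_iso b.symm)

variable {P}

theorem isIso_or_isIso_of_isIso_add {X Y : P.Quotient} (hX : IsInvertible X) (a b : X ⟶ Y)
    [IsIso (a + b)] : IsIso a ∨ IsIso b :=
  hX.isIso_or_isIso_of_isIso_add (P.quotientTensorRightShiftUnit 1) P.isZero_or_isZero a b

theorem not_isIso_zero {X Y : P.Quotient} (hX : IsInvertible X) : ¬ IsIso (0 : X ⟶ Y) := by
  intro h
  obtain ⟨X', ⟨i⟩⟩ := hX
  have hid : 𝟙 X = 0 := by rw [← IsIso.hom_inv_id (0 : X ⟶ Y), zero_comp]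
  have hXX' : IsZero (X ⊗ X') := by
    rw [IsZero.iff_id_eq_zero, ← MonoidalCategory.id_whiskerRight, hid,
      MonoidalPreadditive.zero_whiskerRight]
  exact P.unit_notMem (ThickIdeal.isZero_Q_iff.1
    (hXX'.of_iso ((Functor.Monoidal.εIso P.Q).symm ≪≫ i.symm)))

end Spectrum

end QuotientMonoidal

section Picard

variable {K : Type u} [Category.{v} K] [HasShift K ℤ] [MonoidalCategory K] {ι : Type} {x : ι → K}

theorem PicMonoid.unit : PicMonoid x (𝟙_ K) := (shift 0).iso ((shiftFunctorZero K ℤ).app _)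

instance : ObjectProperty.IsMonoidal (PicMonoid x) where
  prop_unit := .unit
  prop_tensor _ _ := .tensor

theorem PicGroup.of_mem {m : K} (hm : PicMonoid x m) : PicGroup x m :=
  ⟨m, 𝟙_ K, hm, .unit, ⟨ρ_ m⟩⟩

theorem PicGroup.unit : PicGroup x (𝟙_ K) := .of_mem .unit

section Preadditive

variable [Preadditive K] {g h k : K} {r : g ⟶ h}

theorem centralRing_of_mem {m : K} (hm : PicMonoid x m) (s : 𝟙_ K ⟶ m) : centralRing x s :=
  ⟨.unit, .of_mem hm, Or.inl ⟨m, hm, ⟨(ρ_ m).symm⟩⟩⟩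

theorem centralRing_add {r' : g ⟶ h} (hr : centralRing x r) (hr' : centralRing x r') :
    centralRing x (r + r') := by
  obtain ⟨hg, hh, hm | rfl⟩ := hr
  · exact ⟨hg, hh, Or.inl hm⟩
  · rwa [zero_add]

theorem centralRing_comp {t : h ⟶ k} (hr : centralRing x r) (ht : centralRing x t) :
    centralRing x (r ≫ t) := by
  obtain ⟨hg, -, ⟨m, hm, ⟨i⟩⟩ | rfl⟩ := hr
  · obtain ⟨-, hk, ⟨n, hn, ⟨j⟩⟩ | rfl⟩ := ht
    · exact ⟨hg, hk, Or.inl ⟨n ⊗ m, hn.tensor hm,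
        ⟨j ≪≫ whiskerLeftIso n i ≪≫ (α_ _ _ _).symm⟩⟩⟩
    · exact ⟨hg, hk, Or.inr comp_zero⟩
  · exact ⟨hg, ht.2.1, Or.inr zero_comp⟩

end Preadditive

section Symmetric

variable [SymmetricCategory K]

theorem PicGroup.tensor {g h : K} (hg : PicGroup x g) (hh : PicGroup x h) : PicGroup x (g ⊗ h) := by
  obtain ⟨m, n, hm, hn, ⟨i⟩⟩ := hg
  obtain ⟨m', n', hm', hn', ⟨i'⟩⟩ := hh
  exact ⟨m ⊗ m', n ⊗ n', hm.tensor hm', hn.tensor hn',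
    ⟨⟨tensorμ g h n n', tensorδ g h n n', by simp, by simp⟩ ≪≫ (i ⊗ᵢ i')⟩⟩

theorem PicGroup.of_tensor_iso {w a c : K} (hw : PicMonoid x w) (ha : PicGroup x a)
    (e : w ⊗ c ≅ a) : PicGroup x c := by
  obtain ⟨m, n, hm, hn, ⟨i⟩⟩ := ha
  exact ⟨m, w ⊗ n, hm, hw.tensor hn,
    ⟨(α_ _ _ _).symm ≪≫ whiskerRightIso (β_ c w ≪≫ e) n ≪≫ i⟩⟩

section Preadditive

variable [Preadditive K] [MonoidalPreadditive K] {g h k : K} {r : g ⟶ h}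

theorem centralRing_whiskerLeft (hk : PicGroup x k) (hr : centralRing x r) :
    centralRing x (k ◁ r) := by
  obtain ⟨hg, hh, hr⟩ := hr
  refine ⟨hk.tensor hg, hk.tensor hh, hr.imp ?_ ?_⟩
  · rintro ⟨m, hm, ⟨i⟩⟩
    exact ⟨m, hm, ⟨whiskerLeftIso k i ≪≫ (α_ _ _ _).symm ≪≫ whiskerRightIso (β_ k m) g ≪≫
      α_ _ _ _⟩⟩
  · rintro rfl
    exact MonoidalPreadditive.whiskerLeft_zero

theorem centralRing_whiskerRight (hk : PicGroup x k) (hr : centralRing x r) :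
    centralRing x (r ▷ k) := by
  obtain ⟨hg, hh, hr⟩ := hr
  refine ⟨hg.tensor hk, hh.tensor hk, hr.imp ?_ ?_⟩
  · rintro ⟨m, hm, ⟨i⟩⟩
    exact ⟨m, hm, ⟨whiskerRightIso i k ≪≫ α_ _ _ _⟩⟩
  · rintro rfl
    exact MonoidalPreadditive.zero_whiskerRight

end Preadditive

end Symmetric

section Triangulated

variable [HasZeroObject K] [Preadditive K] [∀ n : ℤ, (shiftFunctor K n).Additive]
  [Pretriangulated K]

theorem isOpen_invLocus {a b : K} (s : a ⟶ b) : IsOpen (invLocus s) := by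
  obtain ⟨Z, f, g, hT⟩ := distinguished_cocone_triangle s
  exact TopologicalSpace.isOpen_generateFrom_of_mem
    ⟨Z, Set.ext fun P => P.carrier.trW_iff_of_distinguished _ hT⟩

variable [SymmetricCategory K] [TensorTriangulated K]

theorem PicMonoid.shift_mem {m : K} (hm : PicMonoid x m) (d : ℤ) : PicMonoid x (m⟦d⟧) :=
  (hm.tensor (shift d)).iso ((tensorRightShiftUnit d).app m)

theorem PicMonoid.isInvertible (hx : ∀ i, IsInvertible (x i)) {m : K} (hm : PicMonoid x m) :
    IsInvertible m := by
  induction hm with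
  | of i => exact hx i
  | shift d => exact IsInvertible.unit.shift (tensorRightShiftUnit d)
  | tensor _ _ h₁ h₂ => exact h₁.tensor h₂
  | iso e _ h => exact h.of_iso e

theorem PicGroup.isInvertible (hx : ∀ i, IsInvertible (x i)) {g : K} (hg : PicGroup x g) :
    IsInvertible g := by
  obtain ⟨m, n, hm, -, ⟨i⟩⟩ := hg
  obtain ⟨m', ⟨j⟩⟩ := hm.isInvertible hx
  exact ⟨n ⊗ m', ⟨(α_ _ _ _).symm ≪≫ whiskerRightIso i m' ≪≫ j⟩⟩

theorem IsAmple.le_killed (hK : IsRigid K) (hx : ∀ i, IsInvertible (x i)) (ha : IsAmple x)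
    (P : Spectrum K) : P.toThickIdeal ≤ P.toThickIdeal.killed (PicMonoid x) := by
  intro c hc
  obtain ⟨_, ⟨m, hm, s, rfl⟩, hPs, hs⟩ := ha.exists_subset_of_mem_open
    (show P ∈ {P : Spectrum K | P.carrier c} from hc)
    (TopologicalSpace.isOpen_generateFrom_of_mem ⟨c, rfl⟩)
  let J := ThickIdeal.coneIdeal fun _ : Unit => s
  have hJP : J ≤ P.toThickIdeal := ThickIdeal.coneIdeal_le_iff.2 fun _ => hPs
  have hcJ : J.carrier c := J.mem_of_forall_spectrum hK fun P' hP' =>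
    hs (ThickIdeal.coneIdeal_le_iff.1 hP' ())
  have hJ : J ≤ J.killed (PicMonoid x) :=
    ThickIdeal.coneIdeal_le_killed (fun _ => PicMonoid.isInvertible hx) (fun _ => hm) _
  exact ThickIdeal.killed_mono hJP _ (hJ _ hcJ)

end Triangulated

end Picard

section GradedRings

variable {A : ℤ → Type w} [∀ d, AddCommGroup (A d)]

theorem hom_apply_mem {N : ∀ d, AddSubgroup (A d)} {d : ℤ} {a : A d} (ha : a ∈ N d) (e : ℤ) :
    hom a e ∈ N e := by
  obtain rfl | hde := eq_or_ne d e
  · rwa [DirectSum.of_eq_same]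
  · rw [DirectSum.of_eq_of_ne _ _ _ hde.symm]
    exact zero_mem _

variable [DirectSum.GRing A]

theorem hom_mul_hom {d e : ℤ} (a : A d) (b : A e) :
    hom a * hom b = hom (GradedMonoid.GMul.mul a b) :=
  DirectSum.of_mul_of a b

theorem mul_mem_of_hom_mul_mem (S : AddSubgroup (Total A)) (r s : Total A)
    (h : ∀ d e, hom (r d) * hom (s e) ∈ S) : r * s ∈ S := by
  classical
  rw [← DirectSum.sum_support_of r, ← DirectSum.sum_support_of s, Finset.sum_mul_sum]
  exact S.sum_mem fun d _ => S.sum_mem fun e _ => h d e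

namespace HomogeneousPrime

section OfComponents

/-- The elements of `R = ⨁ d, A d` whose components lie in given subgroups `N d` of `A d`. -/
def componentwise (N : ∀ d, AddSubgroup (A d)) : AddSubgroup (Total A) where
  carrier := {r | ∀ d, r d ∈ N d}
  add_mem' hr hs d := (N d).add_mem (hr d) (hs d)
  zero_mem' d := (N d).zero_mem
  neg_mem' hr d := (N d).neg_mem (hr d)

theorem hom_mem_componentwise_iff {N : ∀ d, AddSubgroup (A d)} {d : ℤ} {a : A d} :
    hom a ∈ componentwise N ↔ a ∈ N d :=
  ⟨fun h => by simpa only [DirectSum.of_eq_same] using h d, hom_apply_mem⟩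

variable (N : ∀ d, AddSubgroup (A d)) (hone : GradedMonoid.GOne.one ∉ N 0)
  (hmul : ∀ (d e : ℤ) (a : A d) (b : A e),
    GradedMonoid.GMul.mul a b ∈ N (d + e) ↔ a ∈ N d ∨ b ∈ N e)

/-- The homogeneous prime with given homogeneous components. -/
def ofComponents : HomogeneousPrime A where
  toIdeal :=
    { componentwise N with
      smul_mem' := fun r s hs => mul_mem_of_hom_mul_mem (componentwise N) r s fun d e => by
        rw [hom_mul_hom, hom_mem_componentwise_iff]
        exact (hmul _ _ _ _).2 (Or.inr (hs e)) }
  mul_mem_right s r hs := mul_mem_of_hom_mul_mem (componentwise N) s r fun d e => by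
    rw [hom_mul_hom, hom_mem_componentwise_iff]
    exact (hmul _ _ _ _).2 (Or.inl (hs d))
  component_mem r hr d := hom_mem_componentwise_iff.2 (hr d)
  ne_top := (Ideal.ne_top_iff_one _).2 fun h => hone (hom_mem_componentwise_iff.1 h)
  mem_or_mem d e a b hab := by
    rw [hom_mul_hom] at hab
    exact ((hmul _ _ _ _).1 (hom_mem_componentwise_iff.1 hab)).imp
      hom_mem_componentwise_iff.2 hom_mem_componentwise_iff.2

theorem hom_mem_ofComponents_iff {d : ℤ} {a : A d} :
    hom a ∈ (ofComponents N hone hmul).toIdeal ↔ a ∈ N d :=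
  hom_mem_componentwise_iff

end OfComponents

theorem isTopologicalBasis_basicOpen :
    TopologicalSpace.IsTopologicalBasis
      {U | ∃ (d : ℤ) (f : A d), U = {𝔭 : HomogeneousPrime A | hom f ∉ 𝔭.toIdeal}} where
  eq_generateFrom := rfl
  sUnion_eq := Set.sUnion_eq_univ_iff.2 fun 𝔭 =>
    ⟨_, ⟨0, GradedMonoid.GOne.one, rfl⟩, (Ideal.ne_top_iff_one _).1 𝔭.ne_top⟩
  exists_subset_inter := by
    rintro _ ⟨d, f, rfl⟩ _ ⟨e, g, rfl⟩ 𝔭 ⟨hf, hg⟩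
    refine ⟨_, ⟨d + e, GradedMonoid.GMul.mul f g, rfl⟩, ?_⟩
    simp only [← hom_mul_hom]
    exact ⟨fun h => (𝔭.mem_or_mem d e f g h).elim hf hg, fun 𝔮 h =>
      ⟨fun hf => h (𝔮.mul_mem_right _ _ hf), fun hg => h (𝔮.toIdeal.mul_mem_left _ hg)⟩⟩

end HomogeneousPrime

section GradedHom

variable {B : ℤ → Type*} [∀ d, AddCommGroup (B d)] [DirectSum.GRing B] {f : Total A →+* Total B}

theorem map_hom_component (hf : ∀ (d : ℤ) (a : A d), ∃ b : B d, f (hom a) = hom b) (r : Total A)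
    (d : ℤ) : f (hom (r d)) = hom (f r d) := by
  induction r using DirectSum.induction_on with
  | zero => simp only [DirectSum.zero_apply, map_zero]
  | of e a =>
    obtain ⟨b, hb⟩ := hf e a
    rw [hb]
    obtain rfl | hde := eq_or_ne d e
    · rw [DirectSum.of_eq_same, DirectSum.of_eq_same, hb]
    · simp only [DirectSum.of_eq_of_ne _ _ _ hde, map_zero]
  | add r s hr hs => simp only [DirectSum.add_apply, map_add, hr, hs]

/-- The preimage of a homogeneous prime under a homomorphism of graded rings. -/
def HomogeneousPrime.comap (hf : ∀ (d : ℤ) (a : A d), ∃ b : B d, f (hom a) = hom b)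
    (𝔭 : HomogeneousPrime B) : HomogeneousPrime A where
  toIdeal := 𝔭.toIdeal.comap f
  mul_mem_right a b h := by
    rw [Ideal.mem_comap, map_mul]
    exact 𝔭.mul_mem_right _ _ h
  component_mem a h d := by
    rw [Ideal.mem_comap, map_hom_component hf]
    exact 𝔭.component_mem _ h d
  ne_top := Ideal.comap_ne_top _ 𝔭.ne_top
  mem_or_mem d e a b h := by
    obtain ⟨a', ha⟩ := hf d a
    obtain ⟨b', hb⟩ := hf e b
    simp only [Ideal.mem_comap, map_mul, ha, hb] at h ⊢
    exact 𝔭.mem_or_mem d e a' b' h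

end GradedHom

namespace LocalRing

variable {I : Ideal (Total A)}

theorem ofRing_mul_inv (s : HomCompl I) : ofRing I (hom s.1.2) * inv I s = 1 := by
  rw [ofRing, inv, ← map_mul, RingQuot.mkRingHom_rel (LocRel.mul_inv s), map_one]

theorem inv_mul_ofRing (s : HomCompl I) : inv I s * ofRing I (hom s.1.2) = 1 := by
  rw [ofRing, inv, ← map_mul, RingQuot.mkRingHom_rel (LocRel.inv_mul s), map_one]

theorem exists_isUnit_of_notMem {d e : ℤ} {a : A d} {b : A e} (ha : hom a ∉ I) (hb : hom b ∉ I) :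
    ∃ l, IsHomogeneous I (d - e) l ∧ IsUnit l := by
  let s : HomCompl I := ⟨⟨d, a⟩, ha⟩
  let t : HomCompl I := ⟨⟨e, b⟩, hb⟩
  refine ⟨ofRing I (hom a) * inv I t, ?_, IsUnit.mul ?_ ?_⟩
  · exact sub_eq_add_neg d e ▸ (IsHomogeneous.ofRing a).mul (IsHomogeneous.inv t)
  · exact ⟨⟨_, _, ofRing_mul_inv s, inv_mul_ofRing s⟩, rfl⟩
  · exact ⟨⟨_, _, inv_mul_ofRing t, ofRing_mul_inv t⟩, rfl⟩

section Lift

variable {T : Type*} [Ring T] (φ : Total A →+* T)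
  (hφ : ∀ (d : ℤ) (a : A d), hom a ∉ I → IsUnit (φ (hom a)))

/-- The homomorphism from the localization given by its universal property. -/
def lift : LocalRing I →+* T :=
  RingQuot.lift ⟨(FreeAlgebra.lift ℤ
    (Sum.elim φ fun s => ((hφ s.1.1 s.1.2 s.2).unit⁻¹ : Tˣ))).toRingHom, fun _ _ h => by
      cases h with
      | one => simp
      | add => simp
      | mul => simp
      | mul_inv s => simp
      | inv_mul s => simp⟩

theorem lift_ofRing (r : Total A) : lift φ hφ (ofRing I r) = φ r := by
  simp [lift, ofRing]

end Lift

variable {B : ℤ → Type*} [∀ d, AddCommGroup (B d)] [DirectSum.GRing B]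

theorem IsHomogeneous.exists_map_eq_hom {ψ : LocalRing I →+* Total B}
    (hψ : ∀ (d : ℤ) (a : A d), ∃ b : B d, ψ (LocalRing.ofRing I (hom a)) = hom b)
    (hinv : ∀ (d : ℤ) (a : A d), hom a ∉ I →
      ∃ b : B (-d), ψ (LocalRing.ofRing I (hom a)) * hom b = 1)
    {d : ℤ} {l : LocalRing I} (hl : IsHomogeneous I d l) : ∃ b : B d, ψ l = hom b := by
  induction hl with
  | ofRing a => exact hψ _ a
  | inv s =>
    obtain ⟨b, hb⟩ := hinv s.1.1 s.1.2 s.2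
    have hs : ψ (LocalRing.inv I s) * ψ (LocalRing.ofRing I (hom s.1.2)) = 1 := by
      rw [← map_mul, inv_mul_ofRing, map_one]
    exact ⟨b, left_inv_eq_right_inv hs hb⟩
  | add _ _ ih₁ ih₂ =>
    obtain ⟨b₁, h₁⟩ := ih₁
    obtain ⟨b₂, h₂⟩ := ih₂
    exact ⟨b₁ + b₂, by simp only [map_add, h₁, h₂]⟩
  | mul _ _ ih₁ ih₂ =>
    obtain ⟨b₁, h₁⟩ := ih₁
    obtain ⟨b₂, h₂⟩ := ih₂
    exact ⟨_, by rw [map_mul, h₁, h₂, hom_mul_hom]⟩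

theorem IsHomogeneous.exists_isUnit_hom {φ : Total A →+* Total B}
    (hφ : ∀ (d : ℤ) (a : A d), ∃ b : B d, φ (hom a) = hom b)
    (hI : ∀ (d : ℤ) (a : A d), hom a ∉ I →
      ∃ b : B (-d), φ (hom a) * hom b = 1 ∧ hom b * φ (hom a) = 1)
    {d : ℤ} {l : LocalRing I} (hl : IsHomogeneous I d l) (hu : IsUnit l) :
    ∃ b : B d, IsUnit (hom b) := by
  have hunit (d : ℤ) (a : A d) (ha : hom a ∉ I) : IsUnit (φ (hom a)) := by
    obtain ⟨b, h₁, h₂⟩ := hI d a ha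
    exact ⟨⟨_, _, h₁, h₂⟩, rfl⟩
  obtain ⟨b, hb⟩ := hl.exists_map_eq_hom (ψ := lift φ hunit)
    (fun d a => by simpa only [lift_ofRing] using hφ d a)
    (fun d a ha => (hI d a ha).imp fun b hb => by rw [lift_ofRing, hb.1])
  exact ⟨b, hb ▸ hu.map _⟩

end LocalRing

end GradedRings

section GradedEnd

variable {C : Type*} [Category* C] [Preadditive C]

theorem isIso_neg_iff {X Y : C} {f : X ⟶ Y} : IsIso (-f) ↔ IsIso f := by
  have (f : X ⟶ Y) [IsIso f] : IsIso (-f) := ⟨-inv f, by simp, by simp⟩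
  exact ⟨fun _ => neg_neg f ▸ this (-f), fun _ => this f⟩

variable [HasShift C ℤ]

/-- The graded endomorphism ring `⨁ d, Hom(Σᵈ X, X)` is local as a graded ring, where the
isomorphisms `Σᵈ X ≅ X` play the role of the homogeneous units. -/
structure IsGradedLocal (X : C) : Prop where
  not_isIso_zero (d : ℤ) : ¬ IsIso (0 : X⟦d⟧ ⟶ X)
  isIso_or_isIso_of_add (d : ℤ) (a b : X⟦d⟧ ⟶ X) : IsIso (a + b) → IsIso a ∨ IsIso b
  isIso_and_isIso_of_shiftMul (m n k : ℤ) (a : X⟦m⟧ ⟶ X) (b : X⟦n⟧ ⟶ X) (h : n + m = k) :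
    IsIso (shiftMul a b h) → IsIso a ∧ IsIso b

namespace IsGradedLocal

variable {X : C} (hX : IsGradedLocal X)

include hX in
theorem isIso_shiftMul_iff {m n k : ℤ} (a : X⟦m⟧ ⟶ X) (b : X⟦n⟧ ⟶ X) (h : n + m = k) :
    IsIso (shiftMul a b h) ↔ IsIso a ∧ IsIso b := by
  refine ⟨hX.isIso_and_isIso_of_shiftMul m n k a b h, ?_⟩
  rintro ⟨_, _⟩
  unfold shiftMul
  infer_instance

/-- The morphisms `Σᵈ X ⟶ X` which are not isomorphisms. -/
def nonIso (d : ℤ) : AddSubgroup (X⟦d⟧ ⟶ X) where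
  carrier := {a | ¬ IsIso a}
  zero_mem' := hX.not_isIso_zero d
  add_mem' ha hb h := (hX.isIso_or_isIso_of_add d _ _ h).elim ha hb
  neg_mem' := mt isIso_neg_iff.1

variable [∀ n : ℤ, (shiftFunctor C n).Additive]

/-- The maximal homogeneous ideal of the graded endomorphism ring. -/
def prime : HomogeneousPrime (GEnd X) :=
  HomogeneousPrime.ofComponents (A := GEnd X) hX.nonIso
    (not_not.2 (inferInstanceAs (IsIso ((shiftFunctorZero C ℤ).hom.app X))))
    (fun _ _ a b => ((hX.isIso_shiftMul_iff a b _).not).trans not_and_or)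

theorem hom_mem_prime_iff {d : ℤ} {a : X⟦d⟧ ⟶ X} :
    hom (A := GEnd X) a ∈ hX.prime.toIdeal ↔ ¬ IsIso a :=
  HomogeneousPrime.hom_mem_ofComponents_iff ..

include hX in
theorem isIso_of_isUnit {d : ℤ} {a : X⟦d⟧ ⟶ X} (ha : IsUnit (hom (A := GEnd X) a)) : IsIso a := by
  by_contra h
  exact hX.prime.ne_top (Ideal.eq_top_of_isUnit_mem _ (hX.hom_mem_prime_iff.2 h) ha)

end IsGradedLocal

section Functor

variable {D : Type*} [Category* D] [HasShift D ℤ] [Preadditive D] (F : C ⥤ D) [F.CommShift ℤ]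
  [F.Additive]

/-- The morphism `Σᵈ F X ⟶ F X` induced by a morphism `Σᵈ X ⟶ X`. -/
def gEndMap {X : C} {d : ℤ} : (X⟦d⟧ ⟶ X) →+ ((F.obj X)⟦d⟧ ⟶ F.obj X) :=
  AddMonoidHom.mk' (fun a => (F.commShiftIso d).inv.app X ≫ F.map a) (by simp)

theorem isIso_gEndMap_iff {X : C} {d : ℤ} {a : X⟦d⟧ ⟶ X} :
    IsIso (gEndMap F a) ↔ IsIso (F.map a) :=
  isIso_comp_left_iff ((F.commShiftIso d).inv.app X) (F.map a)

theorem gEndMap_one (X : C) :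
    gEndMap F ((shiftFunctorZero C ℤ).hom.app X) = (shiftFunctorZero D ℤ).hom.app (F.obj X) := by
  simp [gEndMap, F.commShiftIso_zero, ← Functor.map_comp]

theorem gEndMap_shiftMul {X : C} {m n k : ℤ} (a : X⟦m⟧ ⟶ X) (b : X⟦n⟧ ⟶ X) (h : n + m = k) :
    gEndMap F (shiftMul a b h) = shiftMul (gEndMap F a) (gEndMap F b) h := by
  have hb : (F.map b)⟦m⟧' ≫ (F.commShiftIso m).inv.app X =
      (F.commShiftIso m).inv.app (X⟦n⟧) ≫ F.map (b⟦m⟧') := (F.commShiftIso m).inv.naturality b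
  have hadd : F.map ((shiftFunctorAdd' C n m k h).inv.app X) ≫
      F.map ((shiftFunctorAdd' C n m k h).hom.app X) = 𝟙 _ := by
    rw [← F.map_comp, Iso.inv_hom_id_app, F.map_id]
  simp only [gEndMap, AddMonoidHom.mk'_apply, shiftMul, F.commShiftIso_add' h,
    Functor.CommShift.isoAdd'_inv_app, Functor.map_comp, Category.assoc, reassoc_of% hadd,
    reassoc_of% hb]

end Functor

variable [∀ n : ℤ, (shiftFunctor C n).Additive]

theorem exists_hom_mul_eq_one {X : C} {d : ℤ} (a : X⟦d⟧ ⟶ X) [IsIso a] :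
    ∃ b : X⟦-d⟧ ⟶ X, IsIso b ∧ hom (A := GEnd X) b * hom (A := GEnd X) a = 1 := by
  have hd : d + -d = 0 := by simp
  let b : X⟦-d⟧ ⟶ X := inv (a⟦-d⟧') ≫ (shiftFunctorAdd' C d (-d) 0 hd).inv.app X ≫
    (shiftFunctorZero C ℤ).hom.app X
  have hba : shiftMul b a hd = (shiftFunctorZero C ℤ).hom.app X := by simp [shiftMul, b]
  refine ⟨b, inferInstance, (hom_mul_hom (A := GEnd X) b a).trans ?_⟩
  exact DirectSum.of_eq_of_gradedMonoid_eq (A := GEnd X)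
    ((mk_shiftMul b a _ hd).trans (congrArg (Sigma.mk (0 : ℤ)) hba))

theorem exists_hom_inverse {X : C} {d : ℤ} (a : X⟦d⟧ ⟶ X) [IsIso a] :
    ∃ b : X⟦-d⟧ ⟶ X, hom (A := GEnd X) a * hom (A := GEnd X) b = 1 ∧
      hom (A := GEnd X) b * hom (A := GEnd X) a = 1 := by
  obtain ⟨b, _, hba⟩ := exists_hom_mul_eq_one a
  obtain ⟨c, -, hcb⟩ := exists_hom_mul_eq_one b
  exact ⟨b, left_inv_eq_right_inv hcb hba ▸ hcb, hba⟩

variable {D : Type*} [Category* D] [HasShift D ℤ] [Preadditive D]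
  [∀ n : ℤ, (shiftFunctor D n).Additive] (F : C ⥤ D) [F.CommShift ℤ] [F.Additive]

/-- The homomorphism of graded endomorphism rings induced by a functor. -/
def gEndRingHom (X : C) : Total (GEnd X) →+* Total (GEnd (F.obj X)) :=
  DirectSum.toSemiring
    (fun d => (DirectSum.of (GEnd (F.obj X)) d).comp (gEndMap F (X := X) (d := d)))
    (congrArg (DirectSum.of (GEnd (F.obj X)) 0) (gEndMap_one F X))
    (fun a b => (congrArg (DirectSum.of (GEnd (F.obj X)) _) (gEndMap_shiftMul F a b _)).trans
      (hom_mul_hom (A := GEnd (F.obj X)) _ _).symm)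

theorem gEndRingHom_hom {X : C} {d : ℤ} (a : X⟦d⟧ ⟶ X) :
    gEndRingHom F X (hom (A := GEnd X) a) = hom (A := GEnd (F.obj X)) (gEndMap F a) :=
  DirectSum.toSemiring_of ..

theorem exists_gEndRingHom_eq_hom {X : C} (d : ℤ) (a : GEnd X d) :
    ∃ b : GEnd (F.obj X) d, gEndRingHom F X (hom a) = hom b :=
  ⟨_, gEndRingHom_hom F a⟩

namespace IsGradedLocal

variable {X : C} (hX : IsGradedLocal (F.obj X))

/-- The homogeneous prime of the elements which do not become invertible under `F`. -/
def comap : HomogeneousPrime (GEnd X) := hX.prime.comap (exists_gEndRingHom_eq_hom F)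

theorem hom_mem_comap_iff {d : ℤ} {a : X⟦d⟧ ⟶ X} :
    hom (A := GEnd X) a ∈ (hX.comap F).toIdeal ↔ ¬ IsIso (F.map a) := by
  rw [comap, HomogeneousPrime.comap, Ideal.mem_comap, gEndRingHom_hom, hom_mem_prime_iff,
    isIso_gEndMap_iff]

variable {F}

include hX in
theorem exists_isIso_of_isUnit {I : Ideal (Total (GEnd X))}
    (hI : ∀ (d : ℤ) (a : X⟦d⟧ ⟶ X), hom (A := GEnd X) a ∉ I → IsIso (F.map a)) {d : ℤ}
    {l : LocalRing I} (hl : LocalRing.IsHomogeneous I d l) (hu : IsUnit l) :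
    ∃ a : (F.obj X)⟦d⟧ ⟶ F.obj X, IsIso a := by
  obtain ⟨a, ha⟩ := hl.exists_isUnit_hom (exists_gEndRingHom_eq_hom F) (fun d a ha => by
    have : IsIso (gEndMap F a) := (isIso_gEndMap_iff F).2 (hI d a ha)
    rw [gEndRingHom_hom F a]
    exact exists_hom_inverse (gEndMap F a)) hu
  exact ⟨a, hX.isIso_of_isUnit ha⟩

end IsGradedLocal

end GradedEnd

section Periods

theorem exists_isIso_map_of_shift {C D : Type*} [Category* C] [Category* D]
    [HasShift C ℤ] [HasShift D ℤ] (F : C ⥤ D) [F.CommShift ℤ] {X Y : C} {n d : ℤ}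
    (b : X⟦n⟧ ⟶ Y⟦d⟧) [IsIso (F.map b)] : ∃ a : X⟦n - d⟧ ⟶ Y, IsIso (F.map a) := by
  have : IsIso (F.map (b⟦-d⟧')) :=
    (NatIso.isIso_map_iff (F.commShiftIso (-d)) b).2 (inferInstanceAs (IsIso ((F.map b)⟦-d⟧')))
  let i : X⟦n - d⟧ ≅ (X⟦n⟧)⟦-d⟧ := (shiftFunctorAdd' C n (-d) (n - d) (by lia)).app X
  let j : (Y⟦d⟧)⟦-d⟧ ≅ Y := (shiftEquiv C d).unitIso.symm.app Y
  refine ⟨i.hom ≫ b⟦-d⟧' ≫ j.hom, ?_⟩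
  rw [F.map_comp, F.map_comp]
  infer_instance

theorem objPeriod_congr {C : Type*} [Category* C] [HasShift C ℤ] {X Y : C} (e : X ≅ Y) :
    objPeriod X = objPeriod Y := by
  have h (d : ℤ) : Nonempty (X ≅ X⟦d⟧) ↔ Nonempty (Y ≅ Y⟦d⟧) :=
    ⟨fun ⟨i⟩ => ⟨e.symm ≪≫ i ≪≫ (shiftFunctor C d).mapIso e⟩,
      fun ⟨i⟩ => ⟨e ≪≫ i ≪≫ (shiftFunctor C d).mapIso e.symm⟩⟩
  simp only [objPeriod, h]

theorem objPeriod_obj_eq_ringPeriodAt {C D : Type*} [Category* C] [Category* D] [Preadditive C]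
    [Preadditive D] [HasShift C ℤ] [HasShift D ℤ] [∀ n : ℤ, (shiftFunctor C n).Additive]
    [∀ n : ℤ, (shiftFunctor D n).Additive] {F : C ⥤ D} [F.CommShift ℤ] [F.Additive] {X : C}
    (hX : IsGradedLocal (F.obj X)) {I : Ideal (Total (GEnd X))}
    (hI : ∀ (d : ℤ) (a : X⟦d⟧ ⟶ X), hom (A := GEnd X) a ∈ I ↔ ¬ IsIso (F.map a))
    (hF : ∀ d : ℤ, ((F.obj X)⟦d⟧ ≅ F.obj X) →
      ∃ (n : ℤ) (a : X⟦n⟧ ⟶ X) (b : X⟦n⟧ ⟶ X⟦d⟧), IsIso (F.map a) ∧ IsIso (F.map b)) :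
    objPeriod (F.obj X) = ringPeriodAt I := by
  have h (d : ℤ) : Nonempty (F.obj X ≅ (F.obj X)⟦d⟧) ↔
      ∃ l : LocalRing I, LocalRing.IsHomogeneous I d l ∧ IsUnit l := by
    constructor
    · rintro ⟨φ⟩
      obtain ⟨n, a, b, ha, _⟩ := hF d φ.symm
      obtain ⟨b', hb'⟩ := exists_isIso_map_of_shift F b
      have hl := LocalRing.exists_isUnit_of_notMem (I := I) (fun h => (hI n a).1 h ha)
        (fun h => (hI _ b').1 h hb')
      rwa [sub_sub_cancel] at hl
    · rintro ⟨l, hl, hu⟩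
      obtain ⟨a, _⟩ := hX.exists_isIso_of_isUnit (fun d a => not_imp_comm.1 (hI d a).2) hl hu
      exact ⟨(asIso a).symm⟩
  simp only [objPeriod, ringPeriodAt, gradedPeriod, h, Set.mem_ofPred_eq]

variable {K : Type u} [Category.{v} K] [HasZeroObject K] [HasShift K ℤ]
  [Preadditive K] [∀ n : ℤ, (shiftFunctor K n).Additive] [Pretriangulated K]
  [MonoidalCategory K] [SymmetricCategory K] [TensorTriangulated K]

theorem Spectrum.isGradedLocal (P : Spectrum K) {Y : P.Quotient} (hY : IsInvertible Y) :
    IsGradedLocal Y where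
  not_isIso_zero d := P.not_isIso_zero (hY.shift (P.quotientTensorRightShiftUnit d))
  isIso_or_isIso_of_add d a b _ :=
    P.isIso_or_isIso_of_isIso_add (hY.shift (P.quotientTensorRightShiftUnit d)) a b
  isIso_and_isIso_of_shiftMul m n k a b h hab := by
    have hm := hY.shift (P.quotientTensorRightShiftUnit m)
    have hn := hY.shift (P.quotientTensorRightShiftUnit n)
    have : IsIso (b⟦m⟧' ≫ a) := by rwa [shiftMul, isIso_comp_left_iff] at hab
    obtain ⟨_, ha⟩ := IsInvertible.isIso_of_comp
      (hn.shift (P.quotientTensorRightShiftUnit m)) hm hY (b⟦m⟧') a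
    exact ⟨ha, isIso_of_reflects_iso b (shiftFunctor P.Quotient m)⟩

section Monoidal

variable {L : Type*} [Category* L] [HasShift L ℤ] [MonoidalCategory L] {F : K ⥤ L} [F.Monoidal]
  [F.CommShift ℤ]

theorem nonempty_tensor_iso_shift (a : K) {b : K} {d : ℤ} (e : F.obj b ≅ (F.obj (𝟙_ K))⟦d⟧) :
    Nonempty (F.obj (a ⊗ b) ≅ (F.obj a)⟦d⟧) :=
  ⟨(Functor.Monoidal.μIso F a b).symm ≪≫
    whiskerLeftIso _ (e ≪≫ ((F.commShiftIso d).app (𝟙_ K)).symm) ≪≫ Functor.Monoidal.μIso F a _ ≪≫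
    F.mapIso ((tensorRightShiftUnit d).app a) ≪≫ (F.commShiftIso d).app a⟩

variable {ι : Type} {x : ι → K}
  (hx : ∀ i, ∃ d : ℤ, Nonempty (F.obj (x i) ≅ (F.obj (𝟙_ K))⟦d⟧))

include hx

theorem PicMonoid.exists_iso_shift {m : K} (hm : PicMonoid x m) :
    ∃ d : ℤ, Nonempty (F.obj m ≅ (F.obj (𝟙_ K))⟦d⟧) := by
  induction hm with
  | of i => exact hx i
  | shift d => exact ⟨d, ⟨(F.commShiftIso d).app _⟩⟩
  | @tensor a b _ _ ha hb =>
    obtain ⟨d, ⟨i⟩⟩ := ha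
    obtain ⟨e, ⟨j⟩⟩ := hb
    obtain ⟨k⟩ := nonempty_tensor_iso_shift a j
    exact ⟨d + e, ⟨k ≪≫ (shiftFunctor L e).mapIso i ≪≫ ((shiftFunctorAdd L d e).app _).symm⟩⟩
  | iso i _ h =>
    obtain ⟨d, ⟨j⟩⟩ := h
    exact ⟨d, ⟨F.mapIso i.symm ≪≫ j⟩⟩

theorem PicGroup.exists_iso_shift {g : K} (hg : PicGroup x g) :
    ∃ d : ℤ, Nonempty (F.obj g ≅ (F.obj (𝟙_ K))⟦d⟧) := by
  obtain ⟨m, n, hm, hn, ⟨i⟩⟩ := hg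
  obtain ⟨d, ⟨j⟩⟩ := hm.exists_iso_shift hx
  obtain ⟨e, ⟨k⟩⟩ := hn.exists_iso_shift hx
  obtain ⟨l⟩ := nonempty_tensor_iso_shift g k
  exact ⟨d + -e, ⟨(shiftEquiv L e).unitIso.app _ ≪≫
    (shiftFunctor L (-e)).mapIso (l.symm ≪≫ F.mapIso i ≪≫ j) ≪≫
    ((shiftFunctorAdd L d (-e)).app _).symm⟩⟩

variable [Preadditive L] [∀ n : ℤ, (shiftFunctor L n).Additive]

theorem Spectrum.period_eq_ringPeriodAt (hK : IsRigid K) (hx' : ∀ i, IsInvertible (x i))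
    (ha : IsAmple x) {P : Spectrum K} {G : L ⥤ P.Quotient} [G.CommShift ℤ] [G.Additive]
    (e : F ⋙ G ≅ P.Q) {I : Ideal (Total (GEnd (F.obj (𝟙_ K))))}
    (hI : ∀ (d : ℤ) (a : (F.obj (𝟙_ K))⟦d⟧ ⟶ F.obj (𝟙_ K)),
      hom (A := GEnd (F.obj (𝟙_ K))) a ∈ I ↔ ¬ IsIso (G.map a)) :
    P.period = ringPeriodAt I := by
  have hX : IsGradedLocal (G.obj (F.obj (𝟙_ K))) :=
    P.isGradedLocal ((IsInvertible.unit.map P.Q).of_iso (e.app (𝟙_ K)).symm)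
  refine (objPeriod_congr (e.app (𝟙_ K)).symm).trans (objPeriod_obj_eq_ringPeriodAt hX hI ?_)
  intro d φ
  obtain ⟨w, c, t, b, hw, ⟨i⟩, ht, hb⟩ := ThickIdeal.exists_fraction_of_le_killed
    (fun _ => PicMonoid.isInvertible hx') (ha.le_killed hK hx' P)
    ((P.Q.commShiftIso d).hom.app (𝟙_ K) ≫
      (((shiftFunctor _ d).mapIso (e.app (𝟙_ K))).symm ≪≫ φ ≪≫ e.app (𝟙_ K)).hom)
  have htQ : IsIso (P.Q.map t) := ThickIdeal.isIso_Q_map_iff.2 ht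
  have hbQ : IsIso (P.Q.map b) := by rw [← hb]; infer_instance
  have htG : IsIso (G.map (F.map t)) := (NatIso.isIso_map_iff e t).2 htQ
  have hbG : IsIso (G.map (F.map b)) := (NatIso.isIso_map_iff e b).2 hbQ
  obtain ⟨n, ⟨ψ⟩⟩ :=
    (PicGroup.of_tensor_iso hw (.of_mem (.shift d)) i).exists_iso_shift (F := F) hx
  refine ⟨n, ψ.inv ≫ F.map b, ψ.inv ≫ F.map t ≫ (F.commShiftIso d).hom.app _, ?_, ?_⟩ <;>
  · simp only [Functor.map_comp]
    infer_instance

end Monoidal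

end Periods

section Comparison

variable {K : Type u} [Category.{v} K] [HasZeroObject K] [HasShift K ℤ]
  [Preadditive K] [∀ n : ℤ, (shiftFunctor K n).Additive] [Pretriangulated K]
  [MonoidalCategory K] [SymmetricCategory K] [TensorTriangulated K]

section Chart

variable {ι : Type} {x : ι → K}

/-- The point `{r | cone r ∉ P}` of the spectrum of the central 2-ring. -/
def Spectrum.centralPrime (hx : ∀ i, IsInvertible (x i)) (P : Spectrum K) : CentralPrime x where
  carrier _ _ r := centralRing x r ∧ ¬ P.ConeMem r
  le_centralRing _ _ _ hr := hr.1
  zero_mem g h hg hh := by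
    refine ⟨⟨hg, hh, Or.inr rfl⟩, fun hn => ?_⟩
    have h0 : IsIso (0 : P.Q.obj g ⟶ P.Q.obj h) := by
      rwa [← P.Q.map_zero, ThickIdeal.isIso_Q_map_iff]
    exact P.not_isIso_zero ((hg.isInvertible hx).map P.Q) h0
  add_mem r r' := by
    rintro ⟨hr, hrP⟩ ⟨hr', hrP'⟩
    refine ⟨centralRing_add hr hr', fun hn => ?_⟩
    have hadd : IsIso (P.Q.map r + P.Q.map r') := by
      rwa [← P.Q.map_add, ThickIdeal.isIso_Q_map_iff]
    have h := P.isIso_or_isIso_of_isIso_add ((hr.1.isInvertible hx).map P.Q)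
      (P.Q.map r) (P.Q.map r')
    rw [ThickIdeal.isIso_Q_map_iff, ThickIdeal.isIso_Q_map_iff] at h
    exact h.elim hrP hrP'
  comp_mem r t hr ht := ⟨centralRing_comp hr.1 ht, fun hn =>
    hr.2 (ThickIdeal.trW_and_trW_of_comp (hr.1.1.isInvertible hx) (ht.1.isInvertible hx)
      (ht.2.1.isInvertible hx) hn).1⟩
  mem_comp t r ht hr := ⟨centralRing_comp ht hr.1, fun hn =>
    hr.2 (ThickIdeal.trW_and_trW_of_comp (ht.1.isInvertible hx) (ht.2.1.isInvertible hx)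
      (hr.1.2.1.isInvertible hx) hn).2⟩
  whiskerLeft_mem k _ _ r hk hr := ⟨centralRing_whiskerLeft hk hr.1,
    mt (ThickIdeal.trW_whiskerLeft_iff (hk.isInvertible hx)).1 hr.2⟩
  whiskerRight_mem r k hk hr := ⟨centralRing_whiskerRight hk hr.1,
    mt (ThickIdeal.trW_whiskerRight_iff (hk.isInvertible hx)).1 hr.2⟩
  ne_top h := by
    have hid : centralRing x (𝟙 (𝟙_ K)) := centralRing_of_mem .unit _
    rw [← h] at hid
    exact hid.2 (P.carrier.trW.id_mem _)
  mem_or_mem r s hr hs h := by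
    by_contra! hn
    exact h.2 (P.carrier.trW.comp_mem _ _ (hn.1 hr) (hn.2 hs))

namespace Chart

variable (hx : ∀ i, IsInvertible (x i)) {P : Spectrum K} {s : Chart x}

include hx in
theorem ideal_le_killed : s.ideal ≤ s.ideal.killed (PicMonoid x) :=
  ThickIdeal.coneIdeal_le_killed (fun _ => PicMonoid.isInvertible hx)
    (fun i => (PicMonoid.of i).shift_mem _) s.sec

theorem ideal_le (hs : P.centralPrime hx ∈ s.domain) : s.ideal ≤ P.toThickIdeal :=
  ThickIdeal.coneIdeal_le_iff.2 fun i => not_not.1 fun h =>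
    hs i ⟨centralRing_of_mem ((PicMonoid.of i).shift_mem _) _, h⟩

section Functor

variable {G : s.ideal.Quotient ⥤ P.Quotient} (e : s.ideal.Q ⋙ G ≅ P.Q)

include e

theorem isIso_map_iff_coneMem_of_fraction {d : ℤ}
    {a : s.ideal.Q.obj ((𝟙_ K)⟦d⟧) ⟶ s.ideal.unit} {k : K} {t : k ⟶ (𝟙_ K)⟦d⟧} {b : k ⟶ 𝟙_ K}
    (ht : s.ideal.carrier.trW t) (h : s.ideal.Q.map t ≫ a = s.ideal.Q.map b) :
    IsIso (G.map ((s.ideal.Q.commShiftIso d).inv.app (𝟙_ K) ≫ a)) ↔ P.ConeMem b := by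
  have : IsIso (s.ideal.Q.map t) := ThickIdeal.isIso_Q_map_iff.2 ht
  have hb : IsIso (G.map (s.ideal.Q.map b)) ↔ P.ConeMem b :=
    (NatIso.isIso_map_iff e b).trans ThickIdeal.isIso_Q_map_iff
  rw [← hb, ← h, G.map_comp, G.map_comp, isIso_comp_left_iff, isIso_comp_left_iff]

theorem not_isIso_map_of_hom_mem_primeAt [G.CommShift ℤ] [G.Additive] {d : ℤ}
    {a : s.ideal.unit⟦d⟧ ⟶ s.ideal.unit}
    (ha : hom (A := s.ring) a ∈ s.primeAt (P.centralPrime hx)) : ¬ IsIso (G.map a) := by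
  have hX : IsGradedLocal (G.obj s.ideal.unit) :=
    P.isGradedLocal ((IsInvertible.unit.map P.Q).of_iso (e.app (𝟙_ K)).symm)
  suffices h : s.primeAt (P.centralPrime hx) ≤ (hX.comap G).toIdeal from
    (hX.hom_mem_comap_iff G).1 (h ha)
  refine Ideal.span_le.2 ?_
  rintro _ ⟨d, a, k, t, b, -, ht, hb, hab, rfl⟩
  exact (hX.hom_mem_comap_iff G).2 (mt (isIso_map_iff_coneMem_of_fraction e ht hab).1 hb.2)

theorem hom_mem_primeAt_of_not_isIso_map {d : ℤ} {a : s.ideal.unit⟦d⟧ ⟶ s.ideal.unit}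
    (ha : ¬ IsIso (G.map a)) : hom (A := s.ring) a ∈ s.primeAt (P.centralPrime hx) := by
  obtain ⟨w, c, t, b, hw, ⟨i⟩, ht, hb⟩ := ThickIdeal.exists_fraction_of_le_killed
    (fun _ => PicMonoid.isInvertible hx) (ideal_le_killed hx)
    ((s.ideal.Q.commShiftIso d).hom.app (𝟙_ K) ≫ a)
  have hc : PicGroup x c := .of_tensor_iso hw (.of_mem (.shift d)) i
  have j : 𝟙_ K ≅ (w⟦-d⟧) ⊗ c :=
    (shiftEquiv K d).unitIso.app (𝟙_ K) ≪≫ (shiftFunctor K (-d)).mapIso (i.symm ≪≫ β_ _ _) ≪≫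
      ((tensorLeft c).commShiftIso (-d)).symm.app w ≪≫ β_ _ _
  have ht' : centralRing x t := ⟨hc, .of_mem (.shift d), Or.inl ⟨w, hw, ⟨i.symm⟩⟩⟩
  have hb' : centralRing x b := ⟨hc, .unit, Or.inl ⟨_, hw.shift_mem _, ⟨j⟩⟩⟩
  have hia : (s.ideal.Q.commShiftIso d).inv.app (𝟙_ K) ≫
      (s.ideal.Q.commShiftIso d).hom.app (𝟙_ K) ≫ a = a := by simp
  have hbP : ¬ P.ConeMem b := by
    rwa [← isIso_map_iff_coneMem_of_fraction e ht hb, hia]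
  exact Ideal.subset_span ⟨d, _, c, t, b, ht', ht, ⟨hb', hbP⟩, hb, by rw [hia]⟩

end Functor

theorem period_eq (hK : IsRigid K) (ha : IsAmple x) (hs : P.centralPrime hx ∈ s.domain) :
    P.period = s.periodAt (P.centralPrime hx) := by
  have hinv : s.ideal.carrier.trW.IsInvertedBy P.Q := fun _ _ f hf =>
    ThickIdeal.isIso_Q_map_iff.2 (ObjectProperty.trW_monotone (ideal_le hx hs) f hf)
  let G : s.ideal.Quotient ⥤ P.Quotient := Localization.lift P.Q hinv s.ideal.Q
  let : G.CommShift ℤ := Functor.commShiftOfLocalization s.ideal.Q s.ideal.carrier.trW ℤ P.Q G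
  let e : s.ideal.Q ⋙ G ≅ P.Q := Localization.fac P.Q hinv s.ideal.Q
  have : G.Additive := (Localization.functor_additive_iff s.ideal.Q s.ideal.carrier.trW G).2
    (Functor.additive_of_iso e.symm)
  refine Spectrum.period_eq_ringPeriodAt (F := s.ideal.Q) (fun i => ⟨-s.deg i, ?_⟩) hK hx ha e
    fun d a => ⟨not_isIso_map_of_hom_mem_primeAt hx e, hom_mem_primeAt_of_not_isIso_map hx e⟩
  have : IsIso (s.ideal.Q.map (s.sec i)) :=
    ThickIdeal.isIso_Q_map_iff.2 (ThickIdeal.trW_coneIdeal s.sec i)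
  exact ⟨(shiftEquiv _ (s.deg i)).unitIso.app _ ≪≫ (shiftFunctor _ (-s.deg i)).mapIso
    (asIso (s.ideal.Q.map (s.sec i)) ≪≫ (s.ideal.Q.commShiftIso (s.deg i)).app (x i)).symm⟩

end Chart

end Chart

namespace Spectrum

/-- The comparison map to the homogeneous spectrum of the graded endomorphism ring of the unit. -/
def comparison (P : Spectrum K) : HomogeneousPrime (GEnd (𝟙_ K)) :=
  (P.isGradedLocal (IsInvertible.unit.map P.Q)).comap P.Q

theorem hom_mem_comparison_iff {P : Spectrum K} {d : ℤ} {f : (𝟙_ K)⟦d⟧ ⟶ 𝟙_ K} :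
    hom (A := GEnd (𝟙_ K)) f ∈ P.comparison.toIdeal ↔ ¬ P.ConeMem f :=
  (IsGradedLocal.hom_mem_comap_iff ..).trans ThickIdeal.isIso_Q_map_iff.not

theorem invLocus_eq_preimage_comparison {d : ℤ} (f : (𝟙_ K)⟦d⟧ ⟶ 𝟙_ K) :
    invLocus ((shiftEquiv K d).unitIso.hom.app (𝟙_ K) ≫ f⟦-d⟧') =
      comparison ⁻¹' {𝔭 | hom (A := GEnd (𝟙_ K)) f ∉ 𝔭.toIdeal} := by
  ext P
  refine Iff.trans ?_ hom_mem_comparison_iff.not_left.symm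
  exact (P.carrier.trW.cancel_left_of_respectsIso _ _).trans
    (MorphismProperty.IsCompatibleWithShift.iff P.carrier.trW f (-d))

theorem isAmple_of_isInducing_comparison {ι : Type} (x : ι → K)
    (h : Topology.IsInducing (comparison (K := K))) : IsAmple x := by
  refine TopologicalSpace.isTopologicalBasis_of_isOpen_of_nhds ?_ fun P U hP hU => ?_
  · rintro _ ⟨m, -, s, rfl⟩
    exact isOpen_invLocus s
  · obtain ⟨_, ⟨_, ⟨d, f, rfl⟩, rfl⟩, hPV, hVU⟩ :=
      (HomogeneousPrime.isTopologicalBasis_basicOpen.isInducing h).exists_subset_of_mem_open hP hU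
    have hs := invLocus_eq_preimage_comparison (K := K) f
    exact ⟨_, ⟨_, .shift (-d), _, rfl⟩, hs ▸ hPV, hs ▸ hVU⟩

theorem period_eq_of_isInducing_comparison (hK : IsRigid K)
    (h : Topology.IsInducing (comparison (K := K))) (P : Spectrum K) :
    P.period = ringPeriodAt P.comparison.toIdeal :=
  period_eq_ringPeriodAt (F := 𝟭 K) (x := PEmpty.elim) nofun hK nofun
    (isAmple_of_isInducing_comparison _ h) P.Q.leftUnitor
    fun _ _ => hom_mem_comparison_iff.trans ThickIdeal.isIso_Q_map_iff.not.symm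

end Spectrum

end Comparison

end TTPeriod

end

theorem mainTheorem7_general {K : Type u} [Category.{v} K] [HasZeroObject K] [HasShift K ℤ]
    [Preadditive K] [∀ n : ℤ, (shiftFunctor K n).Additive] [Pretriangulated K]
    [MonoidalCategory K] [SymmetricCategory K] [TensorTriangulated K] (hK : IsRigid K) :
    (∀ (ι : Type) (x : ι → K), (∀ i, IsInvertible (x i)) → (∀ i, IsBaseFree (x i)) → IsAmple x →
      ∃ comp : Spectrum K → CentralPrime x,
        (∀ (P : Spectrum K) (g h : K) (r : g ⟶ h),
          (comp P).carrier r ↔ centralRing x r ∧ ¬ P.ConeMem r) ∧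
        ∀ P : Spectrum K, comp P ∈ gradedSchemeP x ∧
          ∀ s : Chart x, comp P ∈ s.domain → P.period = s.periodAt (comp P)) ∧
    ∃ comp : Spectrum K → HomogeneousPrime (GEnd (𝟙_ K)),
      (∀ (P : Spectrum K) (d : ℤ) (f : (𝟙_ K)⟦d⟧ ⟶ 𝟙_ K),
        hom (A := GEnd (𝟙_ K)) f ∈ (comp P).toIdeal ↔ ¬ P.ConeMem f) ∧
      (Topology.IsInducing comp →
        ∀ P : Spectrum K, P.period = ringPeriodAt (comp P).toIdeal) := by
  refine ⟨fun ι x hx hb ha => ⟨Spectrum.centralPrime hx, fun _ _ _ _ => Iff.rfl, fun P => ⟨?_, ?_⟩⟩,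
    Spectrum.comparison, fun _ _ _ => Spectrum.hom_mem_comparison_iff,
    Spectrum.period_eq_of_isInducing_comparison hK⟩
  · choose d s hs using fun i => hb i P
    exact Set.mem_iUnion.2 ⟨⟨d, s⟩, fun i h => h.2 (hs i)⟩
  · exact fun _ => Chart.period_eq hx hK ha

theorem mainTheorem7 {K : Type u} [Category.{v} K] [HasZeroObject K] [HasShift K ℤ]
    [Preadditive K] [∀ n : ℤ, (shiftFunctor K n).Additive] [Pretriangulated K]
    [MonoidalCategory K] [SymmetricCategory K] [TensorTriangulated K] (hK : IsRigid K) :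
    -- a finite ample family of base-free line bundles
    (∀ (N : ℕ) (x : Fin N → K), (∀ i, IsLineBundle (x i)) → (∀ i, IsBaseFree (x i)) → IsAmple x →
      ∃ comp : Spectrum K → CentralPrime x,
        (∀ (P : Spectrum K) (g h : K) (r : g ⟶ h),
          (comp P).carrier r ↔ centralRing x r ∧ ¬ P.ConeMem r) ∧
        ∀ P : Spectrum K, comp P ∈ gradedSchemeP x ∧
          ∀ s : Chart x, comp P ∈ s.domain → P.period = s.periodAt (comp P)) ∧
    -- the graded endomorphism ring of the unit
    ∃ comp : Spectrum K → HomogeneousPrime (GEnd (𝟙_ K)),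
      (∀ (P : Spectrum K) (d : ℤ) (f : (𝟙_ K)⟦d⟧ ⟶ 𝟙_ K),
        hom (A := GEnd (𝟙_ K)) f ∈ (comp P).toIdeal ↔ ¬ P.ConeMem f) ∧
      (Topology.IsEmbedding comp →
        ∀ P : Spectrum K, P.period = ringPeriodAt (comp P).toIdeal) := by
  obtain ⟨h₁, comp, hcomp, h₂⟩ := mainTheorem7_general hK
  exact ⟨fun N x hx => h₁ (Fin N) x fun i => (hx i).1, comp, hcomp, fun h => h₂ h.isInducing⟩
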